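/- Let $k$ be a field of characteristic $0$ and let $K$ be a function field over $k$, i.e. a finitely generated field extension of $k$ of transcendence degree at least $1$. Let $\overline{K}$ be an algebraic closure of $K$. A variety over a field is a geometrically integral, separated scheme of finite type over it, and a curve is a variety of dimension $1$. A variety (or curve) $Y$ over $\overline{K}$ is called constant if there is a variety $Y_0$ over $k$ with $Y\cong (Y_0)_{\overline{K}}$ over $\overline{K}$. A cover of degree $d$ of an integral scheme $Y$ is a finite morphism $Z\to Y$, where $Z$ is a reduced scheme with irreducible components $Z_1,\dots,Z_n$ such that each restriction $Z_i\to Y$ is surjective and the sum of the degrees of the morphisms $Z_i\to Y$ equals $d$. A scheme $T$ over $\overline{K}$ is dominated by a cover of degree $d$ of a variety $Y$ over $\overline{K}$ if there are a cover $Z\to Y$ of degree $d$ and a dominant morphism $Z\to T$ over $\overline{K}$. Let $X$ be a curve over $K$ and let $d$ be a non-negative integer. If $X_{\overline{K}}$ is dominated by a cover of degree $d$ of a constant variety over $\overline{K}$, then there is an integer $e\le d$ such that $X_{\overline{K}}$ is dominated by a cover of degree $e$ of a constant curve over $\overline{K}$. -/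

import Mathlib

open CategoryTheory CategoryTheory.Limits AlgebraicGeometry

universe u

namespace ConstantCovers

/-- A function field over `k`: a finitely generated field extension of transcendence degree at
least one. -/
structure IsFunctionField (k K : Type u) [Field k] [Field K] [Algebra k K] : Prop where
  fg : (⊤ : IntermediateField k K).FG
  one_le_trdeg : 1 ≤ Algebra.trdeg k K

/-- The morphism `Spec L ⟶ Spec K` given by a field extension `L / K`. -/
noncomputable abbrev specMap (K L : Type u) [Field K] [Field L] [Algebra K L] :
    Spec (CommRingCat.of L) ⟶ Spec (CommRingCat.of K) :=
  Spec.map (CommRingCat.ofHom (algebraMap K L))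

/-- The base change `X_L` of a scheme `X` over `K`, for a field extension `L / K`. -/
noncomputable abbrev baseChange {K : Type u} [Field K] {X : Scheme.{u}}
    (p : X ⟶ Spec (CommRingCat.of K)) (L : Type u) [Field L] [Algebra K L] : Scheme.{u} :=
  pullback p (specMap K L)

/-- The structure morphism `X_L ⟶ Spec L`. -/
noncomputable abbrev baseChangeHom {K : Type u} [Field K] {X : Scheme.{u}}
    (p : X ⟶ Spec (CommRingCat.of K)) (L : Type u) [Field L] [Algebra K L] :
    baseChange p L ⟶ Spec (CommRingCat.of L) :=
  pullback.snd p (specMap K L)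

/-- A variety over a field `K`: a geometrically integral, separated scheme of finite type. -/
structure IsVariety {K : Type u} [Field K] {X : Scheme.{u}}
    (p : X ⟶ Spec (CommRingCat.of K)) : Prop where
  geometricallyIntegral : GeometricallyIntegral p
  isSeparated : IsSeparated p
  locallyOfFiniteType : LocallyOfFiniteType p
  quasiCompact : QuasiCompact p

/-- A curve over a field `K`: a variety of dimension one (neither smooth nor proper in general). -/
structure IsCurve {K : Type u} [Field K] {X : Scheme.{u}}
    (p : X ⟶ Spec (CommRingCat.of K)) : Prop extends IsVariety p where
  dim_eq_one : topologicalKrullDim X = 1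

/-- A scheme `p : Y ⟶ Spec L` is constant over the subfield `k` if it is isomorphic, over `L`, to
the base change of a variety over `k`. -/
def IsConstant (k : Type u) {L : Type u} [Field k] [Field L] [Algebra k L] {Y : Scheme.{u}}
    (p : Y ⟶ Spec (CommRingCat.of L)) : Prop :=
  ∃ (Y₀ : Scheme.{u}) (p₀ : Y₀ ⟶ Spec (CommRingCat.of k)) (e : Y ≅ baseChange p₀ L),
    IsVariety p₀ ∧ e.hom ≫ baseChangeHom p₀ L = p

/-- `f : Z ⟶ Y` is a cover of degree `d` of the integral scheme `Y`: `f` is finite, `Z` is reduced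
with finitely many irreducible components, each of which maps onto `Y`, and the degrees over `Y` of
these components (with their reduced structure) add up to `d`. The component of a reduced scheme
`Z` with generic point `z` has function field `κ(z)`, so its degree over `Y` is `[κ(z) : κ(f z)]`,
where `f z` is the generic point of `Y`. -/
structure IsCover {Z Y : Scheme.{u}} (f : Z ⟶ Y) (d : ℕ) : Prop where
  isIntegral : IsIntegral Y
  isFinite : IsFinite f
  isReduced : IsReduced Z
  finite_irreducibleComponents : (irreducibleComponents Z).Finite
  image_component : ∀ W ∈ irreducibleComponents Z, f '' W = Set.univ
  sum_degree : ∑ᶠ z ∈ genericPoints Z, f.residueDegree z = d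

/-- `q : T ⟶ Spec L` is dominated by a cover of degree `d` of the scheme `p : Y ⟶ Spec L`: there
are a cover `f : Z ⟶ Y` of degree `d` and a dominant morphism `Z ⟶ T` over `L`. -/
def IsDominatedByCover {L : Type u} [Field L] {T Y : Scheme.{u}}
    (q : T ⟶ Spec (CommRingCat.of L)) (p : Y ⟶ Spec (CommRingCat.of L)) (d : ℕ) : Prop :=
  ∃ (Z : Scheme.{u}) (f : Z ⟶ Y) (g : Z ⟶ T), IsCover f d ∧ IsDominant g ∧ g ≫ q = f ≫ p

/-- `T` is dominated by a cover of degree `d` of a variety over `L` that is constant over `k`. -/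
def IsDominatedByCoverOfConstantVariety (k : Type u) {L : Type u} [Field k] [Field L] [Algebra k L]
    {T : Scheme.{u}} (q : T ⟶ Spec (CommRingCat.of L)) (d : ℕ) : Prop :=
  ∃ (Y : Scheme.{u}) (p : Y ⟶ Spec (CommRingCat.of L)),
    IsVariety p ∧ IsConstant k p ∧ IsDominatedByCover q p d

/-- `T` is dominated by a cover of degree `d` of a curve over `L` that is constant over `k`. -/
def IsDominatedByCoverOfConstantCurve (k : Type u) {L : Type u} [Field k] [Field L] [Algebra k L]
    {T : Scheme.{u}} (q : T ⟶ Spec (CommRingCat.of L)) (d : ℕ) : Prop :=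
  ∃ (Y : Scheme.{u}) (p : Y ⟶ Spec (CommRingCat.of L)),
    IsCurve p ∧ IsConstant k p ∧ IsDominatedByCover q p d

end ConstantCovers

/-!
Let `L` be an algebraic closure of `K`. The function field of the curve `X_L` has transcendence
degree one over `L`, so a morphism from an integral scheme to `X_L` is dominant as soon as the
pullback of one fixed nonconstant function `y` is transcendental over `L`; for maps that factor
through a fixed one this is `ConstantCovers.exists_transcendental_of_dominates_curve`. Given a
cover of `(Y₀)_L` of degree `d` that dominates `X_L`, one may replace it by a component that
dominates `X_L`, and `Y₀` by an affine open subscheme `Spec R₀`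
(`ConstantCovers.IsCover.exists_affine_component`). The cover is then given by a finite extension
`B` of `L ⊗ R₀` of rank at most `d`, and `y` by a fraction `b / h` that is transcendental over `L`.
The idea is to restrict the cover to `C_L`, for a suitable curve `C` that maps to `Y₀` and is
defined over `k`.

Restricting means specializing the characteristic polynomial of `b` (up to denominators). As
`b / h` is transcendental, one of its coefficients, suitably normalized, is not in `L`
(`exists_forall_coeff_charpoly_ne`). This says that one element of `L ⊗ R₀` is not an `L`-multiple
of another, which survives restriction to `C_L` when the restriction of functions from `Y₀` to `C`
is injective on a certain finite-dimensional subspace of `R₀`. Since `L` is algebraically closed,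
the specialized characteristic polynomial then has a root that is transcendental over `L` after the
same normalization, and this root is the value of `b` on some component of the restricted cover
(`exists_algHom_eq_of_isRoot_charpoly`). The degree of this component is at most that of `B`. See
`exists_specialization_finite_polynomial`.

The required curve is the content of `exists_algHom_finite_polynomial`: a geometrically integral
finitely generated algebra `R₀` over a field `k` of characteristic zero has a geometrically
integral one-dimensional specialization that is injective on a given finite-dimensional subspace.
The proof works over any such `k`, countable or not. By Noether normalization `R₀` is finite over
affine space, and the curve is the preimage of a rational curve `s ↦ (aᵢ - s ^ Nᵢ - cᵢ s)`. Rapidly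
growing exponents `Nᵢ` make the restriction of polynomials of bounded degree injective, by
Kronecker substitution. Suitable slopes `cᵢ` make the preimage with generic `a` geometrically
irreducible: by an argument of Zariski and Matsusaka (`exists_shearedField_insert`), the field
`k(a)` is algebraically closed in the function field of that preimage. Finally the theorem of
Bertini and Noether (`Polynomial.exists_forall_irreducible_specialization`), proved with an
ultraproduct-like quotient of a product of fields, allows a choice of `a` with coordinates in `k`.
-/

/-! ### Relative algebraic closedness and purely transcendental extensions -/

section

open IntermediateField in
/-- An element of a purely transcendental extension `M(z)` that is algebraic over `M` lies in
`M`. -/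
theorem AlgebraicIndependent.mem_bot_of_mem_adjoin {ι M F : Type*} [Field M] [Field F] [Algebra M F]
    {z : ι → F} (hz : AlgebraicIndependent M z) {y : F}
    (hy : y ∈ adjoin M (Set.range z)) (halg : IsAlgebraic M y) :
    y ∈ (⊥ : IntermediateField M F) := by
  by_cases hy0 : y = 0
  · rw [hy0]; exact zero_mem _
  have hint : IsIntegral (MvPolynomial ι M) (hz.reprField ⟨y, hy⟩) := by
    have h1 : IsIntegral M (⟨y, hy⟩ : adjoin M (Set.range z)) :=
      (isIntegral_algHom_iff (adjoin M (Set.range z)).val Subtype.val_injective).1 halg.isIntegral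
    exact (h1.map hz.reprField).tower_top
  obtain ⟨p, hp⟩ := IsIntegrallyClosed.isIntegral_iff.1 hint
  have hpy : MvPolynomial.aeval z p = y := by
    have := hz.lift_reprField ⟨y, hy⟩
    rw [← hp] at this
    simpa using this
  have hpalg : IsAlgebraic M p := by
    rw [← hpy] at halg
    exact (isAlgebraic_algHom_iff (MvPolynomial.aeval z) hz).1 halg
  have hp0 : p ≠ 0 := by
    rintro rfl
    exact hy0 (by rw [← hpy, map_zero])
  have hu : IsUnit p := hpalg.isIntegral.isUnit hp0
  obtain ⟨r, -, hr⟩ := MvPolynomial.isUnit_iff_eq_C_of_isReduced.1 hu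
  rw [← hpy, hr, MvPolynomial.aeval_C]
  exact IntermediateField.algebraMap_mem _ _

attribute [local instance] MvPolynomial.algebraMvPolynomial in
open IntermediateField in
/-- Let `M` be algebraically closed in `E`. Then `M(z)` is algebraically closed in the purely
transcendental extension `E(z)`. -/
theorem AlgebraicIndependent.mem_adjoin_of_isAlgebraic {ι M E F : Type*} [Field M] [Field E]
    [Field F] [Algebra M E] [Algebra E F] [Algebra M F] [IsScalarTower M E F]
    (hM : ∀ e : E, IsAlgebraic M e → e ∈ Set.range (algebraMap M E))
    {z : ι → F} (hz : AlgebraicIndependent E z) {y : F}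
    (hy : y ∈ adjoin E (Set.range z)) (halg : IsAlgebraic (adjoin M (Set.range z)) y) :
    y ∈ adjoin M (Set.range z) := by
  rw [isAlgebraic_adjoin_iff] at halg
  obtain ⟨a, ha0, ha⟩ := halg.exists_integral_multiple
  have hsub : ∀ b ∈ Algebra.adjoin M (Set.range z), b ∈ adjoin E (Set.range z) := by
    intro b hb
    induction hb using Algebra.adjoin_induction with
    | mem x hx => exact subset_adjoin _ _ hx
    | algebraMap r =>
      rw [IsScalarTower.algebraMap_apply M E F]; exact IntermediateField.algebraMap_mem _ _
    | add x y _ _ hx hy => exact add_mem hx hy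
    | mul x y _ _ hx hy => exact mul_mem hx hy
  have hay : (a : F) * y ∈ adjoin E (Set.range z) := mul_mem (hsub _ a.2) hy
  -- the multiple `a * y` is a polynomial in `z` over `E`
  have hcomp : ∀ q : MvPolynomial ι M, MvPolynomial.aeval z (MvPolynomial.map (algebraMap M E) q) =
      MvPolynomial.aeval z q := fun q => by rw [MvPolynomial.aeval_map_algebraMap]
  have hev : ((MvPolynomial.aeval (R := M) z : MvPolynomial ι M →ₐ[M] F) :
      MvPolynomial ι M →+* F).IsIntegralElem
      ((a : F) * y) := by
    obtain ⟨f, hf, hf0⟩ := ha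
    have hzM : AlgebraicIndependent M z := hz.restrictScalars (algebraMap M E).injective
    refine ⟨f.map (hzM.aevalEquiv.symm : _ →+* _), hf.map _, ?_⟩
    rw [Polynomial.eval₂_map]
    convert hf0 using 2
    · ext b
      simp only [RingHom.comp_apply]
      exact hzM.aeval_repr b
    · rfl
  have hpoly : IsIntegral (MvPolynomial ι M) (hz.reprField ⟨(a : F) * y, hay⟩) := by
    obtain ⟨f, hf, hf0⟩ := hev
    refine ⟨f, hf, ?_⟩
    apply (IsFractionRing.lift (algebraicIndependent_iff_injective_aeval.2 hz)).injective
    rw [map_zero, ← hf0, Polynomial.hom_eval₂, hz.lift_reprField]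
    congr 1
    ext q
    · simp [IsScalarTower.algebraMap_apply (MvPolynomial ι M) (MvPolynomial ι E)
        (FractionRing (MvPolynomial ι E)), ← IsScalarTower.algebraMap_apply M E F]
    · simp [IsScalarTower.algebraMap_apply (MvPolynomial ι M) (MvPolynomial ι E)
        (FractionRing (MvPolynomial ι E))]
  obtain ⟨p, hp⟩ := IsIntegrallyClosed.isIntegral_iff.1 (hpoly.tower_top (A := MvPolynomial ι E))
  have hpint : IsIntegral (MvPolynomial ι M) p := by
    rw [← hp] at hpoly
    exact (isIntegral_algebraMap_iff (IsFractionRing.injective _ _)).1 hpoly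
  have hpy : MvPolynomial.aeval z p = (a : F) * y := by
    have := hz.lift_reprField ⟨(a : F) * y, hay⟩
    rw [← hp] at this
    simpa using this
  have hcoeff := MvPolynomial.isIntegral_iff_isIntegral_coeff.1 hpint
  obtain ⟨q, hq⟩ : p ∈ Set.range (MvPolynomial.map (σ := ι) (algebraMap M E)) := by
    rw [MvPolynomial.mem_range_map_iff_coeffs_subset]
    intro c hc
    obtain ⟨n, hn, rfl⟩ := MvPolynomial.mem_coeffs_iff.1 hc
    exact hM _ (hcoeff n).isAlgebraic
  have hqy : MvPolynomial.aeval z q = (a : F) * y := by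
    rw [← hcomp]
    exact (congrArg _ hq).trans hpy
  have ha0' : (a : F) ≠ 0 := fun h => ha0 (Subtype.ext h)
  rw [← mul_div_cancel_left₀ y ha0', ← hqy]
  refine div_mem ?_ (algebra_adjoin_le_adjoin M _ a.2)
  exact algebra_adjoin_le_adjoin M _ (Algebra.adjoin_range_eq_range_aeval M z ▸ ⟨q, rfl⟩)

namespace IntermediateField

variable {k F : Type*} [Field k] [Field F] [Algebra k F]

theorem mem_of_mem_sup_adjoin {ι : Type*} (M : IntermediateField k F) {z : ι → F}
    (hz : AlgebraicIndependent M z) {y : F} (hy : y ∈ M ⊔ adjoin k (Set.range z))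
    (halg : IsAlgebraic M y) : y ∈ M := by
  rw [← restrictScalars_adjoin_eq_sup, mem_restrictScalars] at hy
  obtain ⟨m, rfl⟩ := mem_bot.1 (hz.mem_bot_of_mem_adjoin hy halg)
  exact m.2

theorem mem_sup_adjoin_of_isAlgebraic {ι : Type*} {M E : IntermediateField k F} (hME : M ≤ E)
    (hM : ∀ e ∈ E, IsAlgebraic M e → e ∈ M) {z : ι → F}
    (hz : AlgebraicIndependent E z) {y : F} (hy : y ∈ E ⊔ adjoin k (Set.range z))
    (halg : IsAlgebraic (M ⊔ adjoin k (Set.range z) : IntermediateField k F) y) :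
    y ∈ M ⊔ adjoin k (Set.range z) := by
  rw [← restrictScalars_adjoin_eq_sup, mem_restrictScalars] at hy ⊢
  rw [← restrictScalars_adjoin_eq_sup] at halg
  let _ : Algebra M E := (inclusion hME).toAlgebra
  have : IsScalarTower M E F := .of_algebraMap_eq fun _ => rfl
  refine AlgebraicIndependent.mem_adjoin_of_isAlgebraic (E := E) (fun e he => ?_) hz hy halg
  have : IsAlgebraic M (e : F) := he.algebraMap
  exact ⟨⟨e, hM e e.2 this⟩, rfl⟩

end IntermediateField

end

/-! ### Shears of a transcendence basis -/

section

open IntermediateField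

variable {k F : Type*} [Field k] [Field F] [Algebra k F]

theorem IsTranscendenceBasis.of_range_subset_adjoin {ι : Type*} [Finite ι] {x y : ι → F}
    (hx : IsTranscendenceBasis k x) (h : ∀ i, x i ∈ adjoin k (Set.range y)) :
    IsTranscendenceBasis k y := by
  have hle : adjoin k (Set.range x) ≤ adjoin k (Set.range y) :=
    adjoin_le_iff.2 (by rintro _ ⟨i, rfl⟩; exact h i)
  have h1 : Algebra.IsAlgebraic (adjoin k (Set.range y)) F := by
    have := hx.isAlgebraic_field
    exact ⟨fun a => by
      let _ := (inclusion hle).toAlgebra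
      have : IsScalarTower (adjoin k (Set.range x)) (adjoin k (Set.range y)) F :=
        .of_algebraMap_eq fun _ => rfl
      exact (Algebra.IsAlgebraic.isAlgebraic (R := adjoin k (Set.range x)) a).tower_top _⟩
  have h2 := isAlgebraic_adjoin_iff_top.1 h1
  exact Algebra.IsAlgebraic.isTranscendenceBasis_of_lift_le_trdeg_of_finite k y
    hx.lift_cardinalMk_eq_trdeg.le

/-- The field generated by the `v i + c i * s` for `i ∈ S`, where `v = (s, (v i)ᵢ)`. -/
noncomputable def shearedField {σ : Type*} (v : Option σ → F) (c : σ → k) (S : Set σ) :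
    IntermediateField k F :=
  adjoin k ((fun i => v (some i) + algebraMap k F (c i) * v none) '' S)

theorem shearedField_mono {σ : Type*} (v : Option σ → F) (c : σ → k) {S T : Set σ} (h : S ⊆ T) :
    shearedField v c S ≤ shearedField v c T :=
  adjoin.mono _ _ _ (Set.image_mono h)

/-- Over the field generated by the sheared coordinates `v i + c i * s`, `i ∈ S`, and
`v j + γ * s`, a second shear `v j + γ' * s` of the `j`-th coordinate and the coordinates not yet
sheared are algebraically independent: together they generate `k(v)`, because the two shears of
`v j` recover `s`. -/
theorem algebraicIndependent_shear {σ : Type*} [Finite σ] [DecidableEq σ] {v : Option σ → F}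
    (hv : IsTranscendenceBasis k v) (c : σ → k) (S : Finset σ) (j : σ) {γ γ' : k}
    (hγ : γ ≠ γ') :
    AlgebraicIndependent (shearedField v (Function.update c j γ) (insert j S : Finset σ))
      (fun i : ((some '' (insert j S : Finset σ))ᶜ : Set (Option σ)) =>
        (i : Option σ).elim (v (some j) + algebraMap k F γ' * v none) (fun i => v (some i))) := by
  set c' := Function.update c j γ with hc'
  let w : Option σ → F := fun o => o.elim (v (some j) + algebraMap k F γ' * v none)
    (fun i => if i ∈ insert j S then v (some i) + algebraMap k F (c' i) * v none else v (some i))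
  have hw0 : w none = v (some j) + algebraMap k F γ' * v none := rfl
  have hw1 : ∀ i ∈ insert j S, w (some i) = v (some i) + algebraMap k F (c' i) * v none :=
    fun i hi => if_pos hi
  have hw2 : ∀ i ∉ insert j S, w (some i) = v (some i) := fun i hi => if_neg hi
  have hmem : ∀ i, w i ∈ adjoin k (Set.range w) := fun i => subset_adjoin _ _ ⟨i, rfl⟩
  have hk : ∀ a : k, algebraMap k F a ∈ adjoin k (Set.range w) :=
    fun a => IntermediateField.algebraMap_mem _ a
  have hs : v none ∈ adjoin k (Set.range w) := by
    have h1 := hmem none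
    have h2 := hmem (some j)
    rw [hw0] at h1
    rw [hw1 j (Finset.mem_insert_self _ _), hc', Function.update_self] at h2
    have h3 : algebraMap k F (γ' - γ) ≠ 0 := by
      simpa [sub_eq_zero] using hγ.symm
    have h4 := div_mem (sub_mem h1 h2) (hk (γ' - γ))
    convert h4 using 1
    rw [eq_div_iff h3, map_sub]; ring
  have hw : IsTranscendenceBasis k w := by
    refine hv.of_range_subset_adjoin fun o => ?_
    cases o with
    | none => exact hs
    | some i =>
      have h1 := hmem (some i)
      by_cases hi : i ∈ insert j S
      · rw [hw1 i hi] at h1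
        simpa using sub_mem h1 (mul_mem (hk (c' i)) hs)
      · rwa [hw2 i hi] at h1
  have h1 := hw.1.adjoin_of_disjoint
    (disjoint_compl_right (a := (some '' (insert j S : Finset σ) : Set (Option σ))))
  rw [← algebraicIndependent_adjoin_iff, Set.image_image] at h1
  have h2 : shearedField v c' (insert j S : Finset σ) =
      adjoin k ((fun x => w (some x)) '' (insert j S : Finset σ)) := by
    unfold shearedField
    congr 1
    refine Set.image_congr fun i hi => ?_
    exact (hw1 i (by simpa using hi)).symm
  rw [h2]
  convert h1 using 1
  funext i
  rcases i with ⟨_ | i, hi⟩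
  · rfl
  · have : i ∉ insert j S := fun h => hi ⟨i, by simpa using h, rfl⟩
    exact (hw2 i this).symm


/-- Zariski–Matsusaka argument: some shear of one further coordinate keeps the field generated by
the sheared coordinates algebraically closed in `F`. Let `E γ` be the algebraic closure in `F` of
the field belonging to the slope `γ`. There are only finitely many fields between `k(v)` and `F`,
so `E γ` and `E γ'` have the same compositum with `k(v)` for some `γ ≠ γ'`. An element of `E γ'`
then lies in a purely transcendental extension of `E γ`, and this forces it into the field
belonging to `γ'`. -/
theorem exists_shearedField_insert {σ : Type*} [Finite σ] [DecidableEq σ] [CharZero k]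
    {v : Option σ → F} (hv : IsTranscendenceBasis k v)
    [FiniteDimensional (adjoin k (Set.range v)) F] (c : σ → k) (S : Finset σ) {j : σ} (hj : j ∉ S)
    (hc : ∀ y : F, IsAlgebraic (shearedField v c (S : Set σ)) y →
      y ∈ shearedField v c (S : Set σ)) :
    ∃ γ : k, ∀ y : F,
      IsAlgebraic (shearedField v (Function.update c j γ) (insert j S : Finset σ)) y →
        y ∈ shearedField v (Function.update c j γ) (insert j S : Finset σ) := by
  have : CharZero F := charZero_of_injective_algebraMap (algebraMap k F).injective
  set K := adjoin k (Set.range v) with hK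
  have : Finite (IntermediateField K F) :=
    Field.finite_intermediateField_of_exists_primitive_element K F
      (Field.exists_primitive_element K F)
  have : Finite {E : IntermediateField k F // K ≤ E} :=
    Finite.of_equiv _ (extendScalars.orderIso K).symm.toEquiv
  let M : k → IntermediateField k F :=
    fun γ => shearedField v (Function.update c j γ) (insert j S : Finset σ)
  let E : k → IntermediateField k F := fun γ => (algebraicClosure (M γ) F).restrictScalars k
  obtain ⟨γ, γ', hγ, heq⟩ := Finite.exists_ne_map_eq_of_infinite
    (fun γ : k => (⟨E γ ⊔ K, le_sup_right⟩ : {E : IntermediateField k F // K ≤ E}))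
  replace heq : E γ ⊔ K = E γ' ⊔ K := congrArg Subtype.val heq
  have hME : ∀ γ, M γ ≤ E γ := fun γ x hx =>
    mem_algebraicClosure_iff.2 (isAlgebraic_algebraMap (⟨x, hx⟩ : M γ))
  have hcc : ∀ γ, shearedField v c (S : Set σ) ≤ M γ := by
    intro γ
    have : shearedField v c (S : Set σ) = shearedField v (Function.update c j γ) (S : Set σ) := by
      unfold shearedField
      congr 1
      refine Set.image_congr fun i hi => ?_
      rw [Function.update_of_ne]
      rintro rfl
      exact hj hi
    rw [this]
    exact shearedField_mono _ _ (by simp)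
  have hjM : ∀ γ, v (some j) + algebraMap k F γ * v none ∈ M γ := fun γ =>
    subset_adjoin _ _ ⟨j, by simp, by simp⟩
  refine ⟨γ', fun y hy => ?_⟩
  have hyE : y ∈ E γ ⊔ K := by
    rw [heq]
    exact le_sup_left (a := E γ') (mem_algebraicClosure_iff.2 hy)
  -- `z` completes the generators belonging to `γ` to a transcendence basis
  let B : Set (Option σ) := (some '' (insert j S : Finset σ))ᶜ
  let z : B → F := fun i =>
    (i : Option σ).elim (v (some j) + algebraMap k F γ' * v none) (fun i => v (some i))
  have hnone : none ∈ B := by simp [B]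
  have hz0 : z ⟨none, hnone⟩ = v (some j) + algebraMap k F γ' * v none := rfl
  have hzM : AlgebraicIndependent (M γ) z := algebraicIndependent_shear hv c S j hγ
  have hzE : AlgebraicIndependent (E γ) z := by
    let _ : Algebra (M γ) (E γ) := (inclusion (hME γ)).toAlgebra
    have : IsScalarTower (M γ) (E γ) F := .of_algebraMap_eq fun _ => rfl
    have : Algebra.IsAlgebraic (M γ) (E γ) := algebraicClosure.isAlgebraic (M γ) F
    exact hzM.extendScalars (E γ)
  have hzc : AlgebraicIndependent (shearedField v c (S : Set σ)) z := by
    let _ : Algebra (shearedField v c (S : Set σ)) (M γ) := (inclusion (hcc γ)).toAlgebra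
    have : IsScalarTower (shearedField v c (S : Set σ)) (M γ) F := .of_algebraMap_eq fun _ => rfl
    exact hzM.restrictScalars (inclusion (hcc γ)).injective
  -- `E γ` and `z` generate the compositum, since `s` is a combination of two shears of `v j`
  have hle : E γ ⊔ K ≤ E γ ⊔ adjoin k (Set.range z) := by
    refine sup_le le_sup_left (adjoin_le_iff.2 ?_)
    have hk : ∀ a : k, algebraMap k F a ∈ E γ ⊔ adjoin k (Set.range z) :=
      fun a => IntermediateField.algebraMap_mem _ a
    have h1 : v (some j) + algebraMap k F γ' * v none ∈ E γ ⊔ adjoin k (Set.range z) :=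
      le_sup_right (a := E γ) (subset_adjoin _ _ ⟨_, hz0⟩)
    have h2 : ∀ i, v (some i) + algebraMap k F (Function.update c j γ i) * v none ∈ M γ →
        v (some i) + algebraMap k F (Function.update c j γ i) * v none ∈
          E γ ⊔ adjoin k (Set.range z) := fun i hi => le_sup_left (a := E γ) (hME γ hi)
    have hs : v none ∈ E γ ⊔ adjoin k (Set.range z) := by
      have h3 : algebraMap k F (γ' - γ) ≠ 0 := by
        simpa [sub_eq_zero] using hγ.symm
      have h4 := div_mem (sub_mem h1 (le_sup_left (a := E γ) (hME γ (hjM γ)))) (hk (γ' - γ))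
      convert h4 using 1
      rw [eq_div_iff h3, map_sub]; ring
    rintro _ ⟨_ | i, rfl⟩
    · exact hs
    · by_cases hi : i ∈ insert j S
      · have h5 := h2 i (subset_adjoin _ _ ⟨i, by simpa using hi, rfl⟩)
        simpa using sub_mem h5 (mul_mem (hk (Function.update c j γ i)) hs)
      · exact le_sup_right (a := E γ) (subset_adjoin _ _ ⟨⟨some i, by simpa [B] using hi⟩, rfl⟩)
  -- the field `M γ'` is generated over the old sheared field by the coordinate `z none`
  have hM' : M γ' = shearedField v c (S : Set σ) ⊔ adjoin k (z '' {⟨none, hnone⟩}) := by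
    apply le_antisymm
    · refine adjoin_le_iff.2 ?_
      rintro _ ⟨i, hi, rfl⟩
      rcases Finset.mem_insert.1 hi with rfl | hi'
      · refine le_sup_right (a := shearedField v c (S : Set σ)) (subset_adjoin _ _ ?_)
        simp [hz0]
      · refine le_sup_left (b := adjoin k (z '' {⟨none, hnone⟩})) (subset_adjoin _ _ ⟨i, hi', ?_⟩)
        have : i ≠ j := by rintro rfl; exact hj hi'
        simp [this]
    · refine sup_le (hcc γ') (adjoin_le_iff.2 ?_)
      rintro _ ⟨i, rfl, rfl⟩
      exact hjM γ'
  -- `E₀(z)` is algebraically closed in `(E γ)(z)`, where `E₀` is the old sheared field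
  have h1 : y ∈ shearedField v c (S : Set σ) ⊔ adjoin k (Set.range z) := by
    refine mem_sup_adjoin_of_isAlgebraic ((hcc γ).trans (hME γ)) (fun e _ he => hc e he) hzE
      (hle hyE) ?_
    have hle' : M γ' ≤ shearedField v c (S : Set σ) ⊔ adjoin k (Set.range z) := by
      rw [hM']
      exact sup_le_sup_left (adjoin.mono _ _ _ (Set.image_subset_range _ _)) _
    let _ := (inclusion hle').toAlgebra
    have : IsScalarTower (M γ') (shearedField v c (S : Set σ) ⊔ adjoin k (Set.range z) :
      IntermediateField k F) F := .of_algebraMap_eq fun _ => rfl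
    exact IsAlgebraic.tower_top (K := M γ') _ hy
  -- `E₀(z)` is purely transcendental over `M γ' = E₀(z none)`, so `y` lies in the latter
  have h2 := ((AlgebraicIndependent.iff_adjoin_image {⟨none, hnone⟩}).1 hzc).2
  set N := adjoin (shearedField v c (S : Set σ)) (z '' {⟨none, hnone⟩}) with hN
  have h3 : AlgebraicIndepOn N z {⟨none, hnone⟩}ᶜ := algebraicIndependent_adjoin_iff.2 h2
  have h4 : N.restrictScalars k = M γ' := by rw [restrictScalars_adjoin_eq_sup, hM']
  have h5 : y ∈ N := by
    refine mem_of_mem_sup_adjoin N h3 ?_ ?_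
    · rw [← restrictScalars_adjoin_eq_sup, mem_restrictScalars] at h1
      refine adjoin_le_iff.2 ?_ h1
      rintro _ ⟨i, rfl⟩
      by_cases hi : i = ⟨none, hnone⟩
      · refine le_sup_left (a := N) (subset_adjoin _ _ ⟨i, hi, rfl⟩)
      · exact le_sup_right (a := N) (subset_adjoin _ _ ⟨⟨i, hi⟩, rfl⟩)
    · change IsAlgebraic (M γ') y at hy
      rw [← h4] at hy
      exact hy
  rw [← mem_restrictScalars (K := k), h4] at h5
  exact h5

/-- For suitable constants `c i ∈ k` the field `k(v i + c i * s : i)` is algebraically closed in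
`F`, if `k` is. -/
theorem exists_shearedField_isAlgebraicallyClosedIn {σ : Type*} [Finite σ] [CharZero k]
    {v : Option σ → F} (hv : IsTranscendenceBasis k v)
    [FiniteDimensional (adjoin k (Set.range v)) F]
    (hk : ∀ y : F, IsAlgebraic k y → y ∈ (⊥ : IntermediateField k F)) :
    ∃ c : σ → k, ∀ y : F, IsAlgebraic (shearedField v c Set.univ) y →
      y ∈ shearedField v c Set.univ := by
  classical
  have := Fintype.ofFinite σ
  suffices h : ∀ S : Finset σ, ∃ c : σ → k, ∀ y : F, IsAlgebraic (shearedField v c (S : Set σ)) y →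
      y ∈ shearedField v c (S : Set σ) by
    have := h Finset.univ
    rwa [Finset.coe_univ] at this
  intro S
  induction S using Finset.induction_on with
  | empty =>
    refine ⟨0, fun y hy => ?_⟩
    have h0 : shearedField v (0 : σ → k) ((∅ : Finset σ) : Set σ) = ⊥ := by
      simp [shearedField]
    rw [h0] at hy ⊢
    exact hk y (hy.restrictScalars k)
  | insert j S hj ih =>
    obtain ⟨c, hc⟩ := ih
    obtain ⟨γ, hγ⟩ := exists_shearedField_insert hv c S hj hc
    exact ⟨_, hγ⟩

end

/-! ### Irreducibility over extensions of a relatively algebraically closed field -/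

section

open Polynomial

theorem Polynomial.map_mapRingHom_injective {R S : Type*} [CommRing R] [CommRing S] {f : R →+* S}
    (hf : Function.Injective f) :
    Function.Injective (Polynomial.map (mapRingHom f) : R[X][X] → S[X][X]) :=
  map_injective _ (map_injective f hf)

/-- Let `M` be algebraically closed in `F`, let `s ∈ F` be transcendental over `M`, and let `P` be
the minimal polynomial of `x ∈ F` over `M[s]`. The minimal polynomial of `x` over `M̄[s]` is
invariant under the automorphisms of `F̄` over `F`, so it is `P`. -/
theorem Polynomial.irreducible_map_algebraicClosure {M F : Type*} [Field M] [Field F] [Algebra M F]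
    [CharZero F] (hM : ∀ y : F, IsAlgebraic M y → y ∈ Set.range (algebraMap M F)) {s x : F}
    (hs : Transcendental M s) {P : M[X][X]} (hP : P.Monic)
    (hker : ∀ Q : M[X][X], eval₂ (aeval s : M[X] →ₐ[M] F).toRingHom x Q = 0 ↔ P ∣ Q) :
    Irreducible (P.map (mapRingHom (algebraMap M (algebraicClosure M (AlgebraicClosure F))))) := by
  set Ξ := AlgebraicClosure F
  set M' := algebraicClosure M Ξ
  have : CharZero Ξ := charZero_of_injective_algebraMap (algebraMap F Ξ).injective
  have hs' : Transcendental M (algebraMap F Ξ s) :=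
    (transcendental_algebraMap_iff (algebraMap F Ξ).injective).2 hs
  have hs'' : Transcendental M' (algebraMap F Ξ s) := hs'.extendScalars _
  let φ : M'[X] →+* Ξ := (aeval (algebraMap F Ξ s) : M'[X] →ₐ[M'] Ξ).toRingHom
  have hφ : Function.Injective φ := transcendental_iff_injective.1 hs''
  let _ : Algebra M'[X] Ξ := φ.toAlgebra
  have : FaithfulSMul M'[X] Ξ := (faithfulSMul_iff_algebraMap_injective _ _).2 hφ
  have : Module.IsTorsionFree M'[X] Ξ := inferInstance
  set ξ := algebraMap F Ξ x
  have hmap : ∀ Q : M[X][X], aeval ξ (Q.map (mapRingHom (algebraMap M M'))) =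
      algebraMap F Ξ (eval₂ (aeval s : M[X] →ₐ[M] F).toRingHom x Q) := by
    intro Q
    rw [aeval_def, eval₂_map, hom_eval₂]
    congr 1
    ext a
    · simp [RingHom.algebraMap_toAlgebra, φ, IsScalarTower.algebraMap_apply M F Ξ]
    · simp [RingHom.algebraMap_toAlgebra, φ]
  have hint : IsIntegral M'[X] ξ := by
    refine ⟨P.map (mapRingHom (algebraMap M M')), hP.map _, ?_⟩
    rw [← aeval_def, hmap, (hker P).2 dvd_rfl, map_zero]
  set G := minpoly M'[X] ξ with hG
  -- conjugation fixes `ξ`, hence maps its minimal polynomial to itself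
  have hGinv : ∀ τ : Ξ ≃ₐ[F] Ξ, ∀ i j, τ ((G.coeff i).coeff j : Ξ) = (G.coeff i).coeff j := by
    intro τ i j
    let τ' : M' ≃ₐ[M] M' := algebraicClosure.algEquivOfAlgEquiv (τ.restrictScalars M)
    have hτ' : ∀ c : M', ((τ' c : M') : Ξ) = τ c := fun c => rfl
    have h0 : aeval ξ (G.map (mapRingHom (τ' : M' →+* M'))) = 0 := by
      have h1 := minpoly.aeval M'[X] ξ
      have h2 := congrArg τ h1
      rw [map_zero] at h2
      rw [← h2, aeval_def, aeval_def, eval₂_map]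
      have h3 := hom_eval₂ (minpoly M'[X] ξ) (algebraMap M'[X] Ξ) (τ : Ξ →+* Ξ) ξ
      refine Eq.trans ?_ h3.symm
      congr 1
      · ext a
        · simp [RingHom.algebraMap_toAlgebra, φ]
          exact hτ' a
        · simp [RingHom.algebraMap_toAlgebra, φ]
      · simp [ξ]
    have h1 : G ∣ G.map (mapRingHom (τ' : M' →+* M')) := minpoly.isIntegrallyClosed_dvd hint h0
    have hmon : G.Monic := minpoly.monic hint
    have h2 := eq_of_monic_of_dvd_of_natDegree_le hmon (hmon.map _) h1
      (hmon.natDegree_map _).le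
    have h3 := congrArg (fun Q => (Q.coeff i).coeff j) h2
    simp only [coeff_map, coe_mapRingHom] at h3
    exact (hτ' _).symm.trans (congrArg Subtype.val h3)
  -- by Galois theory the coefficients lie in `F`, and being algebraic over `M` they lie in `M`
  have hGal : IsGalois F Ξ := inferInstance
  have hcoeff : ∀ i j, (G.coeff i).coeff j ∈ Set.range (algebraMap M M') := by
    intro i j
    have h1 := (InfiniteGalois.mem_bot_iff_fixed (k := F) _).2 fun τ => hGinv τ i j
    obtain ⟨c, hc⟩ := IntermediateField.mem_bot.1 h1
    have h2 : IsAlgebraic M c := by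
      rw [← isAlgebraic_algebraMap_iff (algebraMap F Ξ).injective, hc]
      exact mem_algebraicClosure_iff.1 ((G.coeff i).coeff j).2
    obtain ⟨m, rfl⟩ := hM c h2
    exact ⟨m, Subtype.ext (by rw [← hc]; rfl)⟩
  obtain ⟨G₀, hG₀⟩ : G ∈ lifts (mapRingHom (algebraMap M M')) := by
    refine (lifts_iff_coeff_lifts _).2 fun i => ?_
    have : G.coeff i ∈ lifts (algebraMap M M') := (lifts_iff_coeff_lifts _).2 (hcoeff i)
    exact this
  have hG₀' : G₀.map (mapRingHom (algebraMap M M')) = G := hG₀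
  have h1 : P ∣ G₀ := by
    rw [← hker]
    apply (algebraMap F Ξ).injective
    rw [map_zero, ← hmap, hG₀', hG, minpoly.aeval]
  have h2 : G ∣ P.map (mapRingHom (algebraMap M M')) := by
    refine minpoly.isIntegrallyClosed_dvd hint ?_
    rw [hmap, (hker P).2 dvd_rfl, map_zero]
  have h3 : P.map (mapRingHom (algebraMap M M')) ∣ G := by
    rw [← hG₀']
    exact Polynomial.map_dvd _ h1
  exact (associated_of_dvd_dvd h2 h3).irreducible
      (minpoly.prime_of_isIntegrallyClosed hint).irreducible

attribute [local instance] Polynomial.algebra in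
/-- A monic polynomial over `M[X]` that is irreducible over an algebraically closed algebraic
extension of `M` is irreducible over all extension fields of `M`: the coefficients of its monic
factors are algebraic over `M`. -/
theorem Polynomial.irreducible_map_of_isAlgClosed {M M' Ω : Type*} [Field M] [Field M'] [Field Ω]
    [Algebra M M'] [IsAlgClosed M'] [Algebra M Ω] {P : M[X][X]} (hP : P.Monic)
    (hirr : Irreducible (P.map (mapRingHom (algebraMap M M')))) :
    Irreducible (P.map (mapRingHom (algebraMap M Ω))) := by
  obtain ⟨h1, h2⟩ := (hP.map (mapRingHom (algebraMap M M'))).irreducible_iff_natDegree.1 hirr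
  refine (hP.map _).irreducible_iff_natDegree.2 ⟨fun h => h1 ?_, fun f g hf hg hfg => ?_⟩
  · have : P = 1 := map_mapRingHom_injective (algebraMap M Ω).injective (by simpa using h)
    simp [this]
  set N := algebraicClosure M Ω
  have key : ∀ f : Polynomial (Polynomial Ω), f.Monic → f ∣ P.map (mapRingHom (algebraMap M Ω)) →
      ∃ f' : N[X][X], f'.Monic ∧ f'.map (mapRingHom (algebraMap N Ω)) = f := by
    intro f hf hdvd
    have h3 : ∀ i, IsIntegral M[X] (f.coeff i) := isIntegral_coeff_of_dvd P f hP hf hdvd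
    have h4 : ∀ i j, IsIntegral M ((f.coeff i).coeff j) := fun i =>
      isIntegral_iff_isIntegral_coeff.1 (h3 i)
    have h5 : f ∈ lifts (mapRingHom (algebraMap N Ω)) := by
      refine (lifts_iff_coeff_lifts _).2 fun i => ?_
      have : f.coeff i ∈ lifts (algebraMap N Ω) := (lifts_iff_coeff_lifts _).2
        fun j => ⟨⟨_, mem_algebraicClosure_iff'.2 (h4 i j)⟩, rfl⟩
      exact this
    obtain ⟨f', hf', -, hm⟩ := lifts_and_natDegree_eq_and_monic h5 hf
    exact ⟨f', hm, hf'⟩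
  obtain ⟨f', hf', rfl⟩ := key f hf ⟨g, hfg.symm⟩
  obtain ⟨g', hg', rfl⟩ := key g hg ⟨_, by rw [mul_comm]; exact hfg.symm⟩
  have h3 : f' * g' = P.map (mapRingHom (algebraMap M N)) := by
    apply map_mapRingHom_injective (algebraMap N Ω).injective
    rw [Polynomial.map_mul, hfg, Polynomial.map_map, mapRingHom_comp, ← IsScalarTower.algebraMap_eq]
  let j : N →ₐ[M] M' := IsAlgClosed.lift
  have h4 := h2 (f'.map (mapRingHom j)) (g'.map (mapRingHom j)) (hf'.map _) (hg'.map _) (by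
    rw [← Polynomial.map_mul, h3, Polynomial.map_map, mapRingHom_comp, AlgHom.comp_algebraMap])
  rw [hf'.natDegree_map, hg'.natDegree_map] at h4 ⊢
  exact h4

/-- The minimal polynomial over `M[s]` of an element of an extension `F` in which `M` is
algebraically closed stays irreducible over all extension fields of `M`. -/
theorem Polynomial.irreducible_map_of_isAlgebraicallyClosedIn {M F Ω : Type*} [Field M] [Field F]
    [Algebra M F] [CharZero F] [Field Ω] [Algebra M Ω]
    (hM : ∀ y : F, IsAlgebraic M y → y ∈ Set.range (algebraMap M F)) {s x : F}
    (hs : Transcendental M s) {P : M[X][X]} (hP : P.Monic)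
    (hker : ∀ Q : M[X][X], eval₂ (aeval s : M[X] →ₐ[M] F).toRingHom x Q = 0 ↔ P ∣ Q) :
    Irreducible (P.map (mapRingHom (algebraMap M Ω))) :=
  have := (algebraicClosure.isAlgClosure M (AlgebraicClosure F)).isAlgClosed
  irreducible_map_of_isAlgClosed hP (irreducible_map_algebraicClosure hM hs hP hker)

end

/-! ### Irreducibility of specializations -/

section

open Polynomial

/-- A family of bivariate polynomials of uniformly bounded degrees is a bivariate polynomial over
the product ring. -/
theorem Polynomial.exists_map_evalRingHom_eq {I : Type*} {R : I → Type*} [∀ i, CommRing (R i)]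
    (Q : ∀ i, (R i)[X][X]) {D B : ℕ} (hD : ∀ i, (Q i).natDegree < D)
    (hB : ∀ i j, ((Q i).coeff j).natDegree < B) :
    ∃ q : (∀ i, R i)[X][X], q.degree < D ∧
      ∀ i, q.map (mapRingHom (Pi.evalRingHom R i)) = Q i := by
  refine ⟨∑ j ∈ Finset.range D, monomial j
    (∑ l ∈ Finset.range B, monomial l (fun i => ((Q i).coeff j).coeff l)), ?_, fun i => ?_⟩
  · refine (degree_sum_le _ _).trans_lt
      ((Finset.sup_lt_iff (WithBot.bot_lt_coe D)).2 fun j hj => ?_)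
    exact (degree_monomial_le _ _).trans_lt (WithBot.coe_lt_coe.2 (Finset.mem_range.1 hj))
  · rw [Polynomial.map_sum]
    conv_rhs => rw [(Q i).as_sum_range' D (hD i)]
    refine Finset.sum_congr rfl fun j _ => ?_
    rw [map_monomial]
    congr 1
    rw [coe_mapRingHom, Polynomial.map_sum]
    conv_rhs => rw [((Q i).coeff j).as_sum_range' B (hB i j)]
    simp

theorem Polynomial.Bivariate.coeff_coeff_swap {R : Type*} [CommRing R] (p : R[X][X]) (i j : ℕ) :
    ((swap p).coeff j).coeff i = (p.coeff i).coeff j := by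
  induction p using Polynomial.induction_on' with
  | add p q hp hq => simp [hp, hq]
  | monomial n f =>
    induction f using Polynomial.induction_on' with
    | add f g hf hg =>
      rw [map_add, map_add]
      simp only [coeff_add, hf, hg]
    | monomial m r =>
      rw [swap_monomial_monomial]
      simp only [coeff_monomial]
      split_ifs <;> simp_all [coeff_monomial]

/-- The degree in the first variable of a factor is at most that of the product. -/
theorem Polynomial.natDegree_coeff_le_of_mul {R : Type*} [CommRing R] [IsDomain R] {f g : R[X][X]}
    (h : f * g ≠ 0) {B : ℕ} (hB : ∀ i, ((f * g).coeff i).natDegree ≤ B) (i : ℕ) :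
    (f.coeff i).natDegree ≤ B := by
  have h1 : (Bivariate.swap (f * g)).natDegree ≤ B := by
    refine natDegree_le_iff_coeff_eq_zero.2 fun n hn => ?_
    ext m
    rw [Bivariate.coeff_coeff_swap, coeff_eq_zero_of_natDegree_lt ((hB m).trans_lt hn), coeff_zero]
  have h2 : Bivariate.swap f * Bivariate.swap g ≠ 0 := by
    rw [← map_mul]
    exact (map_ne_zero_iff _ Bivariate.swap.injective).2 h
  rw [map_mul, natDegree_mul (left_ne_zero_of_mul h2) (right_ne_zero_of_mul h2)] at h1
  refine natDegree_le_iff_coeff_eq_zero.2 fun n hn => ?_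
  rw [← Bivariate.coeff_coeff_swap,
    coeff_eq_zero_of_natDegree_lt (p := Bivariate.swap f) (by omega),
    coeff_zero]

/-- Bertini–Noether: if a monic bivariate polynomial over `k[σ]` is irreducible over all fields
containing `k[σ]`, then almost all of its specializations at `k`-points are irreducible over all
extension fields of `k`. Otherwise the factorizations over extension fields `Ω f` of `k` of
specializations outside the zero sets of all `f` give a factorization over `∏ f, Ω f`, hence over a
field containing `k[σ]`. -/
theorem Polynomial.exists_forall_irreducible_specialization {k : Type u} [Field k] {σ : Type}
    {P : (MvPolynomial σ k)[X][X]} (hP : P.Monic)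
    (hirr : ∀ (Ω : Type u) [Field Ω] (φ : MvPolynomial σ k →+* Ω), Function.Injective φ →
      Irreducible (P.map (mapRingHom φ))) :
    ∃ f : MvPolynomial σ k, f ≠ 0 ∧ ∀ a : σ → k, MvPolynomial.eval a f ≠ 0 →
      ∀ (Ω : Type u) [Field Ω] [Algebra k Ω],
        Irreducible (P.map (mapRingHom ((algebraMap k Ω).comp (MvPolynomial.eval a)))) := by
  by_contra! hcon
  have hP1 : P ≠ 1 := by
    rintro rfl
    have := hirr (FractionRing (MvPolynomial σ k)) (algebraMap _ _) (IsFractionRing.injective _ _)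
    rw [Polynomial.map_one] at this
    exact not_irreducible_one this
  choose a ha Ω hΩ hkΩ hred using fun f : {f : MvPolynomial σ k // f ≠ 0} => hcon f f.2
  let ρ : ∀ f, MvPolynomial σ k →+* Ω f := fun f =>
      (algebraMap k (Ω f)).comp (MvPolynomial.eval (a f))
  have hPρ : ∀ f, (P.map (mapRingHom (ρ f))).natDegree = P.natDegree := fun f => hP.natDegree_map _
  have hD : P.natDegree ≠ 0 := fun h => hP1 (hP.natDegree_eq_zero.1 h)
  have h1 : ∀ f, ∃ G H : (Ω f)[X][X], G.Monic ∧ H.Monic ∧ G * H = P.map (mapRingHom (ρ f)) ∧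
      G.natDegree ≠ 0 ∧ H.natDegree ≠ 0 := by
    intro f
    have h2 := hred f
    rw [(hP.map _).irreducible_iff_natDegree] at h2
    push Not at h2
    refine h2 fun h => hD ?_
    rw [← hPρ f, h, natDegree_one]
  choose G H hG hH hGH hG0 hH0 using h1
  -- the degrees are bounded uniformly, so the factors assemble to polynomials over the product
  obtain ⟨B, hB⟩ : ∃ B, ∀ i, (P.coeff i).natDegree ≤ B := by
    refine ⟨P.support.sup fun i => (P.coeff i).natDegree, fun i => ?_⟩
    by_cases hi : i ∈ P.support
    · exact Finset.le_sup (f := fun i => (P.coeff i).natDegree) hi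
    · simp [notMem_support_iff.1 hi]
  have hBρ : ∀ f i, ((P.map (mapRingHom (ρ f))).coeff i).natDegree ≤ B := fun f i => by
    rw [coeff_map]
    exact natDegree_map_le.trans (hB i)
  have hdeg : ∀ f, (G f).natDegree + (H f).natDegree = P.natDegree := fun f => by
    rw [← hPρ f, ← hGH, (hG f).natDegree_mul (hH f)]
  have hne : ∀ f, G f * H f ≠ 0 := fun f => ((hG f).mul (hH f)).ne_zero
  obtain ⟨G', hG'deg, hG'⟩ := exists_map_evalRingHom_eq G (D := P.natDegree) (B := B + 1)
    (fun f => by have := hdeg f; have := hH0 f; omega)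
    (fun f i => Nat.lt_succ_of_le (natDegree_coeff_le_of_mul (hne f)
      (fun i => by rw [hGH]; exact hBρ f i) i))
  obtain ⟨H', hH'deg, hH'⟩ := exists_map_evalRingHom_eq H (D := P.natDegree) (B := B + 1)
    (fun f => by have := hdeg f; have := hG0 f; omega)
    (fun f i => Nat.lt_succ_of_le
      (natDegree_coeff_le_of_mul (g := G f) (by rw [mul_comm]; exact hne f)
      (fun i => by rw [mul_comm, hGH]; exact hBρ f i) i))
  let r : MvPolynomial σ k →+* ∀ f, Ω f := RingHom.pi ρ
  have hGH' : G' * H' = P.map (mapRingHom r) := by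
    ext i j f
    have h2 : (G' * H').map (mapRingHom (Pi.evalRingHom Ω f)) =
        (P.map (mapRingHom r)).map (mapRingHom (Pi.evalRingHom Ω f)) := by
      rw [Polynomial.map_mul, hG', hH', hGH, Polynomial.map_map, mapRingHom_comp]
      rfl
    have h3 := congrArg (fun Q => (Q.coeff i).coeff j) h2
    simp only [coeff_map, coe_mapRingHom] at h3 ⊢
    exact h3
  -- a prime ideal of the product avoiding the images of the nonzero polynomials
  let S : Submonoid (∀ f, Ω f) := (nonZeroDivisors (MvPolynomial σ k)).map r
  have hS : Disjoint ((⊥ : Ideal (∀ f, Ω f)) : Set (∀ f, Ω f)) S := by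
    rw [Set.disjoint_left]
    rintro x hx ⟨f, hf, hfx⟩
    have hf0 : f ≠ 0 := nonZeroDivisors.ne_zero hf
    have h2 : r f ⟨f, hf0⟩ = 0 := by
      rw [hfx, show x = 0 from hx]; rfl
    have h3 : algebraMap k (Ω ⟨f, hf0⟩) (MvPolynomial.eval (a ⟨f, hf0⟩) f) = 0 := h2
    exact ha ⟨f, hf0⟩ ((map_eq_zero _).1 h3)
  obtain ⟨p, hp, -, hpS⟩ := Ideal.exists_le_prime_disjoint ⊥ S hS
  let q : (∀ f, Ω f) →+* FractionRing ((∀ f, Ω f) ⧸ p) :=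
    (algebraMap ((∀ f, Ω f) ⧸ p) _).comp (Ideal.Quotient.mk p)
  have hinj : Function.Injective (q.comp r) := by
    rw [injective_iff_map_eq_zero]
    intro f hf
    by_contra hf0
    have h2 : Ideal.Quotient.mk p (r f) = 0 := by
      apply IsFractionRing.injective ((∀ f, Ω f) ⧸ p) (FractionRing ((∀ f, Ω f) ⧸ p))
      rw [map_zero]; exact hf
    exact Set.disjoint_left.1 hpS (Ideal.Quotient.eq_zero_iff_mem.1 h2)
      ⟨f, mem_nonZeroDivisors_of_ne_zero hf0, rfl⟩
  have h2 := hirr _ (q.comp r) hinj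
  have h3 : G'.map (mapRingHom q) * H'.map (mapRingHom q) = P.map (mapRingHom (q.comp r)) := by
    rw [← Polynomial.map_mul, hGH', Polynomial.map_map, mapRingHom_comp]
  have hn := hP.natDegree_map (mapRingHom (q.comp r))
  have h4 : ∀ Q : (∀ f, Ω f)[X][X], Q.degree < P.natDegree →
      (Q.map (mapRingHom q)).natDegree < P.natDegree := fun Q hQ => by
    refine natDegree_map_le.trans_lt ?_
    by_cases hQ0 : Q = 0
    · rw [hQ0, natDegree_zero]; omega
    · exact (natDegree_lt_iff_degree_lt hQ0).2 hQ
  have h5 : G'.map (mapRingHom q) ≠ 0 := fun h => h2.ne_zero (by rw [← h3, h, zero_mul])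
  have h6 : H'.map (mapRingHom q) ≠ 0 := fun h => h2.ne_zero (by rw [← h3, h, mul_zero])
  have h7 := natDegree_mul h5 h6
  rw [h3, hn] at h7
  have h8 := h4 _ hG'deg
  have h9 := h4 _ hH'deg
  rcases h2.isUnit_or_isUnit h3.symm with h | h
  · have := natDegree_eq_zero_of_isUnit h
    omega
  · have := natDegree_eq_zero_of_isUnit h
    omega

end

/-! ### Kronecker substitution and geometric integrality -/

section

open Polynomial TensorProduct

/-- Kronecker substitution: polynomials of bounded degree are not killed by substituting
polynomials in one variable of rapidly growing degrees. -/
theorem MvPolynomial.exists_aeval_ne_zero_of_natDegree_eq (k : Type*) [Field k] (n B : ℕ) :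
    ∃ N : Fin n → ℕ, (∀ i, 2 ≤ N i) ∧ ∀ τ : Fin n → k[X], (∀ i, (τ i).natDegree = N i) →
      ∀ p : MvPolynomial (Fin n) k, p ≠ 0 → (∀ i, p.degreeOf i < B) → aeval τ p ≠ 0 := by
  refine ⟨fun i => (B + 2) ^ (i.1 + 1), fun i => ?_, fun τ hτ p hp hB => ?_⟩
  · calc 2 ≤ B + 2 := by omega
      _ ≤ (B + 2) ^ (i.1 + 1) := Nat.le_self_pow (by omega) _
  have hτ0 : ∀ i, τ i ≠ 0 := by
    intro i h
    have := hτ i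
    rw [h, natDegree_zero] at this
    exact absurd this (by positivity)
  have hdeg : ∀ m : Fin n →₀ ℕ, (∏ i, τ i ^ m i).natDegree =
      ∑ i : Fin n, m i * (B + 2) ^ (i.1 + 1) := by
    intro m
    rw [natDegree_prod _ _ fun i _ => pow_ne_zero _ (hτ0 i)]
    simp [hτ]
  have hlt : ∀ m ∈ p.support, ∀ i, m i < B + 2 := fun m hm i =>
    (monomial_le_degreeOf i hm).trans_lt ((hB i).trans (by omega))
  have hinj : ∀ m ∈ p.support, ∀ m' ∈ p.support,
      ∑ i : Fin n, m i * (B + 2) ^ (i.1 + 1) = ∑ i : Fin n, m' i * (B + 2) ^ (i.1 + 1) →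
        m = m' := by
    intro m hm m' hm' h
    have h' : ∑ i : Fin n, (B + 2) ^ i.1 * m i = ∑ i : Fin n, (B + 2) ^ i.1 * m' i := by
      have h2 : ∀ m : Fin n →₀ ℕ, ∑ i : Fin n, m i * (B + 2) ^ (i.1 + 1) =
          (B + 2) * ∑ i : Fin n, (B + 2) ^ i.1 * m i := by
        intro m
        rw [Finset.mul_sum]
        exact Finset.sum_congr rfl fun i _ => by ring
      rw [h2, h2] at h
      exact Nat.eq_of_mul_eq_mul_left (by omega) h
    refine Finsupp.ext <| congrFun <| List.ofFn_inj.mp ?_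
    have hl := hlt m hm
    have hl' := hlt m' hm'
    apply Nat.ofDigits_inj_of_len_eq (b := B + 2) (by omega)
      (by simp) (by simpa [List.mem_ofFn] using hl) (by simpa [List.mem_ofFn] using hl')
    simpa only [Nat.ofDigits_eq_sum_mapIdx, List.mapIdx_eq_ofFn, List.get_ofFn, List.length_ofFn,
      Fin.val_cast, mul_comm, List.sum_ofFn] using! h'
  have hne : ∀ m ∈ p.support, Polynomial.C (MvPolynomial.coeff m p) * ∏ i, τ i ^ m i ≠ 0 :=
      fun m hm =>
    mul_ne_zero (Polynomial.C_ne_zero.2 (mem_support_iff.1 hm))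
      (Finset.prod_ne_zero_iff.2 fun i _ => pow_ne_zero _ (hτ0 i))
  have hnd : ∀ m ∈ p.support, (Polynomial.C (MvPolynomial.coeff m p) * ∏ i, τ i ^ m i).degree =
      ((∑ i : Fin n, m i * (B + 2) ^ (i.1 + 1) : ℕ) : WithBot ℕ) := fun m hm => by
    rw [degree_eq_natDegree (hne m hm), natDegree_C_mul (mem_support_iff.1 hm), hdeg]
  have hae : aeval τ p =
      ∑ m ∈ p.support, Polynomial.C (MvPolynomial.coeff m p) * ∏ i, τ i ^ m i := by
    rw [aeval_def, eval₂_eq']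
    rfl
  obtain ⟨m₀, hm₀⟩ := support_nonempty.2 hp
  rw [hae, ← degree_ne_bot, degree_sum_eq_of_disjoint]
  · intro h
    have := Finset.le_sup (f := fun m =>
        (Polynomial.C (MvPolynomial.coeff m p) * ∏ i, τ i ^ m i).degree) hm₀
    rw [h, le_bot_iff, degree_eq_bot] at this
    exact hne _ hm₀ this
  · rintro m ⟨hm, -⟩ m' ⟨hm', -⟩ hmm h
    simp only [Function.comp_apply] at h
    rw [hnd m hm, hnd m' hm'] at h
    exact hmm (hinj m hm m' hm' (by exact_mod_cast h))

theorem TensorProduct.isDomain_of_isFractionRing {k Ω D E : Type*} [Field k] [Field Ω]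
    [Algebra k Ω] [CommRing D] [IsDomain D] [Algebra k D] [Field E] [Algebra D E] [Algebra k E]
    [IsScalarTower k D E] [IsFractionRing D E] [IsDomain (Ω ⊗[k] D)] : IsDomain (Ω ⊗[k] E) := by
  let j : Ω ⊗[k] D →ₐ[Ω] Ω ⊗[k] E :=
    Algebra.TensorProduct.map (AlgHom.id Ω Ω) (IsScalarTower.toAlgHom k D E)
  have hden : ∀ x : Ω ⊗[k] E, ∃ d : D, d ≠ 0 ∧ ∃ y, (1 ⊗ₜ algebraMap D E d) * x = j y := by
    intro x
    induction x with
    | zero => exact ⟨1, one_ne_zero, 0, by simp⟩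
    | tmul ω e =>
      obtain ⟨a, b, hb, rfl⟩ := IsFractionRing.div_surjective (A := D) e
      have hb0 : algebraMap D E b ≠ 0 := by
        simpa using nonZeroDivisors.ne_zero hb
      refine ⟨b, nonZeroDivisors.ne_zero hb, ω ⊗ₜ a, ?_⟩
      simp [j, mul_div_cancel₀ _ hb0]
    | add x x' hx hx' =>
      obtain ⟨d, hd, y, hy⟩ := hx
      obtain ⟨d', hd', y', hy'⟩ := hx'
      refine ⟨d * d', mul_ne_zero hd hd', (1 ⊗ₜ d' : Ω ⊗[k] D) * y + (1 ⊗ₜ d : Ω ⊗[k] D) * y', ?_⟩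
      have h1 : ∀ d : D, j (1 ⊗ₜ d) = 1 ⊗ₜ algebraMap D E d := fun d => by simp [j]
      rw [map_add, map_mul j, map_mul j (1 ⊗ₜ[k] d), ← hy, ← hy', h1, h1]
      simp only [map_mul, ← Algebra.TensorProduct.includeRight_apply (R := k) (A := Ω)]
      ring
  have hunit : ∀ d : D, d ≠ 0 → IsUnit (1 ⊗ₜ algebraMap D E d : Ω ⊗[k] E) := fun d hd => by
    have : algebraMap D E d ≠ 0 := by simpa using hd
    exact (IsUnit.mk0 _ this).map (Algebra.TensorProduct.includeRight : E →ₐ[k] Ω ⊗[k] E)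
  have hj : Function.Injective j :=
    Module.Flat.lTensor_preserves_injective_linearMap (M := Ω)
      (IsScalarTower.toAlgHom k D E).toLinearMap (IsFractionRing.injective D E)
  have hnt : Nontrivial (Ω ⊗[k] E) := inferInstance
  have : NoZeroDivisors (Ω ⊗[k] E) := by
    refine ⟨fun {x x'} hxx => ?_⟩
    obtain ⟨d, hd, y, hy⟩ := hden x
    obtain ⟨d', hd', y', hy'⟩ := hden x'
    have h1 : j (y * y') = 0 := by
      rw [map_mul, ← hy, ← hy', mul_mul_mul_comm, hxx, mul_zero]
    have h2 : y * y' = 0 := hj (by rw [h1, map_zero])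
    rcases mul_eq_zero.1 h2 with rfl | rfl
    · left; rw [map_zero] at hy; exact ((hunit d hd).mul_right_eq_zero).1 hy
    · right; rw [map_zero] at hy'; exact ((hunit d' hd').mul_right_eq_zero).1 hy'
  exact NoZeroDivisors.to_isDomain _

/-- If `k̄ ⊗ E` is a domain, then `k` is algebraically closed in `E`. -/
theorem mem_bot_of_isDomain_tensorProduct {k E : Type*} [Field k] [Field E] [Algebra k E]
    [IsDomain (AlgebraicClosure k ⊗[k] E)] {y : E} (hy : IsAlgebraic k y) :
    y ∈ (⊥ : IntermediateField k E) := by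
  set Ω := AlgebraicClosure k
  have h1 : aeval (1 ⊗ₜ y : Ω ⊗[k] E) ((minpoly k y).map (algebraMap k Ω)) = 0 := by
    rw [aeval_map_algebraMap]
    have := aeval_algHom_apply (Algebra.TensorProduct.includeRight : E →ₐ[k] Ω ⊗[k] E)
        y (minpoly k y)
    rw [minpoly.aeval, map_zero] at this
    exact this
  have hsplit := IsAlgClosed.splits ((minpoly k y).map (algebraMap k Ω))
  rw [hsplit.eq_prod_roots_of_monic ((minpoly.monic hy.isIntegral).map _), map_multiset_prod,
    Multiset.prod_eq_zero_iff, Multiset.map_map, Multiset.mem_map] at h1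
  obtain ⟨α, -, hα⟩ := h1
  have h2 : (1 ⊗ₜ y : Ω ⊗[k] E) = α ⊗ₜ 1 := by
    simpa [sub_eq_zero, Algebra.TensorProduct.algebraMap_apply] using hα
  by_contra hybot
  have h3 : y ∉ Submodule.span k {(1 : E)} := by
    rw [Submodule.mem_span_singleton]
    rintro ⟨c, rfl⟩
    exact hybot (IntermediateField.mem_bot.2 ⟨c, by rw [Algebra.smul_def, mul_one]⟩)
  obtain ⟨f, hf, hf1⟩ := Submodule.exists_le_ker_of_notMem h3
  have h4 := congrArg (TensorProduct.rid k Ω ∘ LinearMap.lTensor Ω f) h2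
  have h5 : f 1 = 0 := hf1 (Submodule.mem_span_singleton_self _)
  simp [h5] at h4
  exact hf h4

end

/-! ### Primitive elements up to a denominator -/

section

open Polynomial

/-- A finite extension `T ⊆ R` of domains of characteristic zero is, up to a denominator in `T`,
generated by one element. -/
theorem exists_smul_mem_adjoin_singleton (T R : Type*) [CommRing T] [IsDomain T] [CharZero T]
    [CommRing R] [IsDomain R] [Algebra T R] [Module.Finite T R] [FaithfulSMul T R] :
    ∃ x : R, ∃ δ : T, δ ≠ 0 ∧ ∀ r : R, δ • r ∈ Algebra.adjoin T {x} := by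
  classical
  let K := FractionRing T
  let E := FractionRing R
  let _ : Algebra K E := FractionRing.liftAlgebra T E
  have : IsScalarTower T K E := FractionRing.isScalarTower_liftAlgebra T E
  have : IsLocalization (Algebra.algebraMapSubmonoid R (nonZeroDivisors T)) E :=
    inferInstance
  have : FiniteDimensional K E := .of_isLocalization T R (nonZeroDivisors T)
  have : CharZero K := charZero_of_injective_algebraMap (IsFractionRing.injective T K)
  obtain ⟨α, hα⟩ := Field.exists_primitive_element K E
  obtain ⟨⟨x, ⟨_, d, hd, rfl⟩⟩, hx⟩ := IsLocalization.surj
    (Algebra.algebraMapSubmonoid R (nonZeroDivisors T)) α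
  have hd0 : algebraMap T K d ≠ 0 := by simpa using nonZeroDivisors.ne_zero hd
  have hx' : algebraMap R E x = algebraMap T K d • α := by
    rw [← hx, Algebra.smul_def, mul_comm, ← IsScalarTower.algebraMap_apply,
      ← IsScalarTower.algebraMap_apply]
  have htop : Algebra.adjoin K {algebraMap R E x} = ⊤ := by
    have h1 := IntermediateField.adjoin_simple_toSubalgebra_of_isAlgebraic
      (Algebra.IsAlgebraic.isAlgebraic (R := K) α)
    rw [hα] at h1
    rw [eq_top_iff, ← IntermediateField.top_toSubalgebra (F := K) (E := E), h1]
    refine Algebra.adjoin_le (Set.singleton_subset_iff.2 ?_)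
    have : α = (algebraMap T K d)⁻¹ • algebraMap R E x := by rw [hx', inv_smul_smul₀ hd0]
    rw [this]
    exact Subalgebra.smul_mem _ (Algebra.self_mem_adjoin_singleton _ _) _
  have key : ∀ r : R, ∃ δ : T, δ ≠ 0 ∧ δ • r ∈ Algebra.adjoin T {x} := by
    intro r
    have hr : algebraMap R E r ∈ Algebra.adjoin K {algebraMap R E x} := htop ▸ Algebra.mem_top
    obtain ⟨p, hp⟩ := Algebra.adjoin_mem_exists_aeval _ _ hr
    obtain ⟨b, hb, hb'⟩ := IsLocalization.integerNormalization_spec (nonZeroDivisors T) p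
    refine ⟨b, nonZeroDivisors.ne_zero hb, ?_⟩
    have : b • r = aeval x (IsLocalization.integerNormalization (nonZeroDivisors T) p) := by
      apply IsFractionRing.injective R E
      rw [← aeval_algebraMap_apply, ← aeval_map_algebraMap K, hb', ← algebraMap_smul K b p,
        map_smul (aeval (algebraMap R E x)), hp, algebraMap_smul, Algebra.smul_def,
        Algebra.smul_def, map_mul, ← IsScalarTower.algebraMap_apply]
    rw [this]
    exact aeval_mem_adjoin_singleton _ _
  choose D hD0 hD using key
  obtain ⟨s, hs⟩ := Module.Finite.fg_top (R := T) (M := R)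
  refine ⟨x, ∏ y ∈ s, D y, Finset.prod_ne_zero_iff.2 fun y _ => hD0 y, fun r => ?_⟩
  have hr : r ∈ Submodule.span T (s : Set R) := hs ▸ Submodule.mem_top
  induction hr using Submodule.span_induction with
  | mem y hy =>
    rw [← Finset.prod_erase_mul _ _ hy, mul_smul]
    exact Subalgebra.smul_mem _ (hD y) _
  | zero => simp
  | add y z _ _ hy hz => rw [smul_add]; exact add_mem hy hz
  | smul t y _ hy => rw [smul_comm]; exact Subalgebra.smul_mem _ hy _

end

/-! ### Irreducibility along the generic curve of a family -/

section

open Polynomial TensorProduct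

theorem Polynomial.isDomain_tensorProduct (k Ω R : Type*) [Field k] [CommRing Ω] [Algebra k Ω]
    [CommRing R] [Algebra k R] [IsDomain (Ω ⊗[k] R)] : IsDomain (Ω ⊗[k] R[X]) := by
  let e : Ω ⊗[k] R[X] ≃ₐ[k] (Ω ⊗[k] R)[X] :=
    (Algebra.TensorProduct.congr (.refl : Ω ≃ₐ[k] Ω) (polyEquivTensor k R)).trans
      ((Algebra.TensorProduct.assoc k k k Ω R k[X]).symm.trans (polyEquivTensor k (Ω ⊗[k] R)).symm)
  exact e.toMulEquiv.isDomain

section GenericLine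

variable {σ k R : Type*} [Field k] [CommRing R] [IsDomain R] [Algebra k R]
  [Algebra (MvPolynomial σ k) R] [IsScalarTower k (MvPolynomial σ k) R]

/-- If `R` is integral over the polynomial ring in the `Xᵢ`, then the `Xᵢ + s ^ Nᵢ` together with
`s` form a transcendence basis of the fraction field of `R[s]`. -/
theorem isTranscendenceBasis_fractionRing_polynomial [Finite σ]
    [Algebra.IsIntegral (MvPolynomial σ k) R]
    [FaithfulSMul (MvPolynomial σ k) R] (N : σ → ℕ) :
    IsTranscendenceBasis k (fun o : Option σ => algebraMap R[X] (FractionRing R[X])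
      (o.elim X fun i => C (algebraMap (MvPolynomial σ k) R (.X i)) + X ^ N i)) := by
  let T := MvPolynomial σ k
  let F := FractionRing R[X]
  let _ : Algebra T[X] R[X] := Polynomial.algebra T R
  have h1 := (MvPolynomial.optionEquivLeft k σ).isTranscendenceBasis
    (IsTranscendenceBasis.mvPolynomial (Option σ) k)
  have hinj : Function.Injective (algebraMap T[X] R[X]) :=
    Polynomial.map_injective _ (FaithfulSMul.algebraMap_injective T R)
  have : FaithfulSMul T[X] R[X] := (faithfulSMul_iff_algebraMap_injective _ _).2 hinj
  have : IsScalarTower T[X] R[X] F := inferInstance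
  have : FaithfulSMul T[X] F := (faithfulSMul_iff_algebraMap_injective _ _).2 <| by
    rw [IsScalarTower.algebraMap_eq T[X] R[X] F]
    exact (IsFractionRing.injective R[X] F).comp hinj
  have : Algebra.IsAlgebraic R[X] F := IsLocalization.isAlgebraic F (nonZeroDivisors R[X])
  have : Algebra.IsAlgebraic T[X] F := Algebra.IsAlgebraic.trans T[X] R[X] F
  have h2 := h1.algebraMap_comp (A := F)
  refine h2.of_range_subset_adjoin fun o => ?_
  set y : Option σ → F := fun o : Option σ => algebraMap R[X] (FractionRing R[X])
      (o.elim X fun i => C (algebraMap (MvPolynomial σ k) R (.X i)) + X ^ N i) with hy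
  have hX : algebraMap R[X] F X ∈ IntermediateField.adjoin k (Set.range y) :=
    IntermediateField.subset_adjoin _ _ ⟨none, rfl⟩
  cases o with
  | none =>
    have : (algebraMap T[X] F ∘ ⇑(MvPolynomial.optionEquivLeft k σ) ∘ MvPolynomial.X) none =
        algebraMap R[X] F X := by
      simp [T, IsScalarTower.algebraMap_apply T[X] R[X] F, Polynomial.algebraMap_def]
    rw [this]
    exact hX
  | some i =>
    have : (algebraMap T[X] F ∘ ⇑(MvPolynomial.optionEquivLeft k σ) ∘ MvPolynomial.X) (some i) =
        y (some i) - algebraMap R[X] F X ^ N i := by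
      simp only [hy, Option.elim, map_add, map_pow]
      rw [add_sub_cancel_right]
      simp [T, IsScalarTower.algebraMap_apply T[X] R[X] F, Polynomial.algebraMap_def]
      rfl
    rw [this]
    exact sub_mem (IntermediateField.subset_adjoin _ _ ⟨some i, rfl⟩) (pow_mem hX _)

theorem finiteDimensional_adjoin_of_isTranscendenceBasis {ι k F : Type*} [Field k] [Field F]
    [Algebra k F] [Algebra.EssFiniteType k F] {v : ι → F} (hv : IsTranscendenceBasis k v) :
    FiniteDimensional (IntermediateField.adjoin k (Set.range v)) F := by
  have h1 : Algebra.IsAlgebraic (IntermediateField.adjoin k (Set.range v)) F := hv.isAlgebraic_field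
  have h2 : Algebra.EssFiniteType (IntermediateField.adjoin k (Set.range v)) F := .of_comp k _ _
  exact Algebra.finite_of_essFiniteType_of_isAlgebraic

end GenericLine

/-- The powers of `x` below the degree of its minimal polynomial over `T` are linearly independent
over `T[X]`, and hence over the fraction field of `T[X]`. -/
theorem Polynomial.eq_zero_of_eval₂_eq_zero_of_degree_lt_minpoly {T R : Type*} [CommRing T]
    [IsDomain T] [IsIntegrallyClosed T] [CommRing R] [IsDomain R] [Algebra T R] [FaithfulSMul T R]
    {x : R} (hx : IsIntegral T x) {Q : T[X][X]} (hQ : Q.degree < (minpoly T x).degree)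
    (h : Q.eval₂ (mapRingHom (algebraMap T R)) (C x) = 0) : Q = 0 := by
  ext i j
  let q : T[X] := ∑ i ∈ Q.support, monomial i ((Q.coeff i).coeff j)
  have hqc : ∀ i, q.coeff i = (Q.coeff i).coeff j := by
    intro i
    simp only [q, finsetSum_coeff, coeff_monomial]
    rw [Finset.sum_ite_eq']
    split_ifs with hi
    · rfl
    · simp [notMem_support_iff.1 hi]
  have hq : aeval x q = 0 := by
    have h1 := congrArg (fun p => p.coeff j) h
    rw [eval₂_eq_sum, sum_def] at h1
    simp only [finsetSum_coeff, ← C_pow, coeff_mul_C, coeff_zero, coe_mapRingHom, coeff_map] at h1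
    simpa [q, map_sum, aeval_monomial] using h1
  have hdvd := minpoly.isIntegrallyClosed_dvd hx hq
  have hq0 : q = 0 := by
    refine eq_zero_of_dvd_of_degree_lt hdvd (lt_of_le_of_lt ?_ hQ)
    refine (degree_le_iff_coeff_zero _ _).2 fun m hm => ?_
    rw [hqc, coeff_eq_zero_of_degree_lt hm, coeff_zero]
  rw [← hqc, hq0]; simp

theorem Polynomial.eq_zero_of_eval₂_fractionRing_eq_zero {T R : Type*} [CommRing T]
    [IsDomain T] [IsIntegrallyClosed T] [CommRing R] [IsDomain R] [Algebra T R] [FaithfulSMul T R]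
    {x : R} (hx : IsIntegral T x) {φ : FractionRing T[X] →+* FractionRing R[X]}
    (hφ : ∀ p : T[X], φ (algebraMap _ _ p) = algebraMap R[X] _ (p.map (algebraMap T R)))
    {Q : (FractionRing T[X])[X]} (hQ : Q.degree < (minpoly T x).degree)
    (h : Q.eval₂ φ (algebraMap R[X] _ (C x)) = 0) : Q = 0 := by
  obtain ⟨b, hb, hb'⟩ := IsLocalization.integerNormalization_spec (nonZeroDivisors T[X]) Q
  set q := IsLocalization.integerNormalization (nonZeroDivisors T[X]) Q
  have hb0 : algebraMap T[X] (FractionRing T[X]) b ≠ 0 := by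
    simpa using nonZeroDivisors.ne_zero hb
  have hbQ : q.map (algebraMap T[X] (FractionRing T[X])) =
      C (algebraMap T[X] (FractionRing T[X]) b) * Q := by
    rw [hb', ← algebraMap_smul (FractionRing T[X]), smul_eq_C_mul]
  have hdeg : q.degree = Q.degree := by
    have := congrArg degree hbQ
    rwa [degree_map_eq_of_injective (IsFractionRing.injective _ _), degree_C_mul hb0] at this
  have hq0 : q = 0 := by
    refine eq_zero_of_eval₂_eq_zero_of_degree_lt_minpoly hx (hdeg ▸ hQ) ?_
    apply IsFractionRing.injective R[X] (FractionRing R[X])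
    rw [map_zero, hom_eval₂]
    have : (algebraMap R[X] (FractionRing R[X])).comp (mapRingHom (algebraMap T R)) =
        φ.comp (algebraMap T[X] (FractionRing T[X])) :=
      RingHom.ext fun p => (hφ p).symm
    rw [this, ← eval₂_map, hbQ, eval₂_mul, h, mul_zero]
  rw [hq0, Polynomial.map_zero] at hbQ
  exact (mul_eq_zero.1 hbQ.symm).resolve_left (C_ne_zero.2 hb0)

/-- The substitution `Xᵢ ↦ Xᵢ - s ^ Nᵢ - cᵢ s`, with `s` the variable of the outer polynomial
ring. Its fibre over a point `a` parametrizes a rational curve in affine space. -/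
noncomputable def curveSubst {σ k : Type*} [CommRing k] (N : σ → ℕ) (c : σ → k) :
    MvPolynomial σ k →ₐ[k] Polynomial (MvPolynomial σ k) :=
  MvPolynomial.aeval fun i => C (MvPolynomial.X i) - X ^ N i - C (MvPolynomial.C (c i)) * X

open IntermediateField in
/-- For suitable slopes `c`, the curves `s ↦ (aᵢ - s ^ Nᵢ - cᵢ s)` with generic `a` have
geometrically irreducible preimages under the finite map given by `x`. -/
theorem exists_forall_irreducible_map_curveSubst {σ k R : Type*} [Finite σ] [Field k] [CharZero k]
    [CommRing R] [IsDomain R] [Algebra k R]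
    [Algebra (MvPolynomial σ k) R] [IsScalarTower k (MvPolynomial σ k) R]
    [Module.Finite (MvPolynomial σ k) R] [FaithfulSMul (MvPolynomial σ k) R]
    [IsDomain (AlgebraicClosure k ⊗[k] R)] (N : σ → ℕ) (x : R) :
    ∃ c : σ → k, ∀ (Ω : Type*) [Field Ω] (φ : MvPolynomial σ k →+* Ω), Function.Injective φ →
      Irreducible (((minpoly (MvPolynomial σ k) x).map (curveSubst N c).toRingHom).map
        (mapRingHom φ)) := by
  let T := MvPolynomial σ k
  let F := FractionRing R[X]
  have hx : IsIntegral T x := Algebra.IsIntegral.isIntegral x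
  set v : Option σ → F := fun o => algebraMap R[X] (FractionRing R[X])
    (o.elim X fun i => C (algebraMap T R (.X i)) + X ^ N i) with hvdef
  have hv : IsTranscendenceBasis k v := isTranscendenceBasis_fractionRing_polynomial N
  have hF0 : CharZero F := charZero_of_injective_algebraMap (algebraMap k F).injective
  have hft : Algebra.FiniteType k R := .trans (S := T) inferInstance inferInstance
  have hft' : Algebra.FiniteType k R[X] := .trans (S := R) inferInstance inferInstance
  have hess : Algebra.EssFiniteType k F := .comp k R[X] F
  have hfd := finiteDimensional_adjoin_of_isTranscendenceBasis hv
  have hdom : IsDomain (AlgebraicClosure k ⊗[k] R[X]) := Polynomial.isDomain_tensorProduct k _ R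
  have hdom' : IsDomain (AlgebraicClosure k ⊗[k] F) :=
    TensorProduct.isDomain_of_isFractionRing (D := R[X])
  obtain ⟨c, hc⟩ := exists_shearedField_isAlgebraicallyClosedIn hv
    fun y hy => mem_bot_of_isDomain_tensorProduct hy
  refine ⟨c, fun Ω _ φ hφ => ?_⟩
  set M := shearedField v c Set.univ with hM
  set s : F := v none with hs
  let u : σ → F := fun i => v (some i) + algebraMap k F (c i) * v none
  have huM : ∀ i, u i ∈ M := fun i => subset_adjoin _ _ ⟨i, trivial, rfl⟩
  have hMu : M = adjoin k (Set.range u) := by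
    rw [hM, shearedField, Set.image_univ]
  let w : Option σ → F := fun o => o.elim s u
  have hsM : ∀ (S : Set F), s ∈ adjoin k S → ∀ i, s ^ N i ∈ adjoin k S := fun S h i => pow_mem h _
  have hw : IsTranscendenceBasis k w := by
    refine hv.of_range_subset_adjoin fun o => ?_
    have hsw : s ∈ adjoin k (Set.range w) := subset_adjoin _ _ ⟨none, rfl⟩
    cases o with
    | none => exact hsw
    | some i =>
      have h1 : u i ∈ adjoin k (Set.range w) := subset_adjoin _ _ ⟨some i, rfl⟩
      have h2 : v (some i) = u i - algebraMap k F (c i) * s := by simp [u, hs]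
      rw [h2]
      exact sub_mem h1 (mul_mem (IntermediateField.algebraMap_mem _ _) hsw)
  have hu : AlgebraicIndependent k u := hw.1.comp some (Option.some_injective _)
  have hst : Transcendental M s := by
    have h1 := (hu.option_iff_transcendental s).1 hw.1
    rw [hMu]
    intro h2
    open scoped IntermediateField.algebraAdjoinAdjoin in
    exact h1 ((IsFractionRing.isAlgebraic_iff (Algebra.adjoin k (Set.range u))
      (adjoin k (Set.range u)) F).2 h2)
  -- the minimal polynomial of `x`, written in terms of `s` and the generators `u i` of `M`
  let θ : T →ₐ[k] M := MvPolynomial.aeval fun i => (⟨u i, huM i⟩ : M)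
  set P : M[X][X] := ((minpoly T x).map (curveSubst N c).toRingHom).map (mapRingHom θ.toRingHom)
  have hP : P.Monic := ((minpoly.monic hx).map _).map _
  have hPdeg : P.degree = (minpoly T x).degree := by
    rw [((minpoly.monic hx).map _).degree_map, (minpoly.monic hx).degree_map]
  have hsub : (((aeval s : M[X] →ₐ[M] F).toRingHom.comp (mapRingHom θ.toRingHom)).comp
      (curveSubst N c).toRingHom) = (algebraMap R[X] F).comp (C.comp (algebraMap T R)) := by
    refine MvPolynomial.ringHom_ext (fun a => ?_) fun i => ?_
    · change aeval s (mapRingHom θ.toRingHom (curveSubst N c (MvPolynomial.C a))) =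
        algebraMap R[X] F (C (algebraMap T R (MvPolynomial.C a)))
      rw [← MvPolynomial.algebraMap_eq, AlgHom.commutes, ← IsScalarTower.algebraMap_apply k T R]
      have h1 : mapRingHom θ.toRingHom (algebraMap k T[X] a) = algebraMap k M[X] a := by
        rw [Polynomial.algebraMap_apply, Polynomial.algebraMap_apply]
        simp
      have h2 : C (algebraMap k R a) = algebraMap k R[X] a := rfl
      rw [h1, h2, ← IsScalarTower.algebraMap_apply k R[X] F]
      exact ((aeval s : M[X] →ₐ[M] F).restrictScalars k).commutes a
    · have h1 : (θ (.X i) : F) = u i := congrArg Subtype.val (MvPolynomial.aeval_X _ i)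
      have h2 : (θ (.C (c i)) : F) = algebraMap k F (c i) := by
        rw [← MvPolynomial.algebraMap_eq, θ.commutes]; rfl
      simp only [curveSubst, AlgHom.toRingHom_eq_coe, RingHom.comp_apply, RingHom.coe_coe,
        MvPolynomial.aeval_X, map_sub, map_mul, map_pow, coe_mapRingHom, map_C,
        Polynomial.map_X, aeval_C, aeval_X]
      change (θ (.X i) : F) - s ^ N i - (θ (.C (c i)) : F) * s = _
      rw [h1, h2]
      simp only [u, hs, hvdef, Option.elim, map_add, map_pow]
      have key : ∀ a b e : F, a + b + e - b - e = a := fun _ _ _ => by ring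
      exact key _ _ _
  have hPx : eval₂ (aeval s : M[X] →ₐ[M] F).toRingHom (algebraMap R[X] F (C x)) P = 0 := by
    rw [eval₂_map, eval₂_map, hsub, ← hom_eval₂, ← hom_eval₂, ← aeval_def,
      minpoly.aeval, map_zero, map_zero]
  have hker : ∀ Q : M[X][X], eval₂ (aeval s : M[X] →ₐ[M] F).toRingHom
      (algebraMap R[X] F (C x)) Q = 0
      ↔ P ∣ Q := by
    intro Q
    refine ⟨fun hQ => ?_, fun ⟨q, hq⟩ => by rw [hq, eval₂_mul, hPx, zero_mul]⟩
    rw [← modByMonic_eq_zero_iff_dvd hP]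
    -- the coefficients of the remainder lie in the fraction field of `T[X]`
    let g : T[X] →+* F := (algebraMap R[X] F).comp (mapRingHom (algebraMap T R))
    have hg : Function.Injective g := (IsFractionRing.injective R[X] F).comp
      (map_injective _ (FaithfulSMul.algebraMap_injective T R))
    let φ' : FractionRing T[X] →+* F := IsFractionRing.lift hg
    have hφ' : ∀ p : T[X], φ' (algebraMap _ _ p) = g p := fun p =>
        IsFractionRing.lift_algebraMap hg p
    let Φ : FractionRing T[X] →ₐ[k] F :=
      AlgHom.mk φ' fun a => by
        rw [IsScalarTower.algebraMap_apply k T[X] (FractionRing T[X])]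
        refine (hφ' _).trans ?_
        rw [Polynomial.algebraMap_apply, MvPolynomial.algebraMap_eq]
        simp only [g, RingHom.comp_apply, coe_mapRingHom, map_C]
        rw [← MvPolynomial.algebraMap_eq, ← IsScalarTower.algebraMap_apply k T R]
        exact (IsScalarTower.algebraMap_apply k R[X] F a).symm
    have hmem : ∀ p : T[X], g p ∈ Φ.fieldRange := fun p => ⟨algebraMap _ _ p, hφ' p⟩
    have hsΦ : s ∈ Φ.fieldRange := by
      have : s = g X := by
        simp only [g, hs, hvdef, RingHom.comp_apply, coe_mapRingHom, Polynomial.map_X]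
        rfl
      exact this ▸ hmem X
    have hMΦ : M ≤ Φ.fieldRange := by
      rw [hMu, adjoin_le_iff]
      rintro _ ⟨i, rfl⟩
      have : u i = g (C (.X i)) + s ^ N i + algebraMap k F (c i) * s := by
        simp [u, hs, hvdef, g]
        rfl
      rw [this]
      exact add_mem (add_mem (hmem _) (pow_mem hsΦ _))
        (mul_mem (Φ.fieldRange.algebraMap_mem _) hsΦ)
    have hrange : ∀ q : M[X], ∃ y, φ' y = aeval s q := by
      intro q
      change aeval s q ∈ Φ.fieldRange
      rw [aeval_eq_sum_range]
      refine sum_mem fun i _ => ?_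
      rw [Algebra.smul_def]
      exact mul_mem (hMΦ (q.coeff i).2) (pow_mem hsΦ _)
    have hr0 : eval₂ (aeval s : M[X] →ₐ[M] F).toRingHom (algebraMap R[X] F (C x)) (Q %ₘ P) = 0 := by
      have := modByMonic_add_div Q P
      rw [← this, eval₂_add, eval₂_mul, hPx, zero_mul, add_zero] at hQ
      exact hQ
    have hrdeg := degree_modByMonic_lt Q hP
    set r := Q %ₘ P
    have hinj : Function.Injective (aeval s : M[X] →ₐ[M] F).toRingHom :=
      transcendental_iff_injective.1 hst
    have hlift : r.map (aeval s : M[X] →ₐ[M] F).toRingHom ∈ lifts φ' := by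
      rw [lifts_iff_coeff_lifts]
      intro i
      obtain ⟨y, hy⟩ := hrange (r.coeff i)
      exact ⟨y, by rw [hy, coeff_map]; rfl⟩
    obtain ⟨r', hr'⟩ := hlift
    have h0 : r' = 0 := by
      refine eq_zero_of_eval₂_fractionRing_eq_zero hx (φ := φ') hφ' ?_ ?_
      · rw [← hPdeg]
        rw [← degree_map r' φ', ← coe_mapRingHom, hr', degree_map_eq_of_injective hinj]
        exact hrdeg
      · rw [eval₂_eq_eval_map, ← coe_mapRingHom, hr', ← eval₂_eq_eval_map]
        exact hr0
    rw [h0, map_zero] at hr'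
    exact (Polynomial.map_eq_zero_iff hinj).1 hr'.symm
  -- the generators `u i` of `M` are algebraically independent, so `φ` extends to `M`
  have hc' : ∀ y : F, IsAlgebraic M y → y ∈ Set.range (algebraMap M F) := fun y hy =>
    ⟨⟨y, hc y hy⟩, rfl⟩
  let e : M ≃ₐ[k] FractionRing T := (equivOfEq hMu).trans hu.aevalEquivField.symm
  let χ : M →+* Ω := (IsFractionRing.lift hφ : FractionRing T →+* Ω).comp e.toRingHom
  have hχ : χ.comp θ.toRingHom = φ := by
    have h1 : ∀ t, e (θ t) = algebraMap T (FractionRing T) t := by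
      intro t
      refine ((AlgEquiv.symm_apply_eq e).1 (Subtype.ext ?_)).symm
      change ((hu.aevalEquivField (algebraMap T (FractionRing T) t) : adjoin k (Set.range u)) : F) =
        M.val (θ t)
      rw [hu.aevalEquivField_algebraMap_apply_coe, ← AlgHom.comp_apply]
      congr 1
      ext i
      simp [θ]
    refine RingHom.ext fun t => ?_
    change IsFractionRing.lift hφ (e (θ t)) = φ t
    rw [h1, IsFractionRing.lift_algebraMap]
  let _ : Algebra M Ω := χ.toAlgebra
  have := irreducible_map_of_isAlgebraicallyClosedIn (Ω := Ω) hc' hst hP hker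
  rw [← hχ, ← mapRingHom_comp, ← Polynomial.map_map]
  exact this

end

/-! ### Specialization of a geometrically integral algebra to a curve -/

section

open Polynomial TensorProduct

theorem AdjoinRoot.isDomain_tensorProduct {k Ω : Type*} [Field k] [Field Ω] [Algebra k Ω]
    {P : k[X][X]} (hP : Irreducible (P.map (mapRingHom (algebraMap k Ω)))) :
    IsDomain (Ω ⊗[k] AdjoinRoot P) := by
  let e₁ := AdjoinRoot.tensorAlgEquiv (R := k) (T := Ω) P _ rfl
  let e₂ : Ω ⊗[k] k[X] ≃+* Polynomial Ω := (polyEquivTensor' k Ω).symm.toRingEquiv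
  have h : (P.map (Algebra.TensorProduct.includeRight : k[X] →ₐ[k] Ω ⊗[k] k[X]).toRingHom).map
      e₂.toRingHom = P.map (mapRingHom (algebraMap k Ω)) := by
    rw [Polynomial.map_map]
    congr 1
    refine RingHom.ext fun p => ?_
    change (polyEquivTensor' k Ω).symm (1 ⊗ₜ p) = _
    simp
  let e₃ := AdjoinRoot.mapRingEquiv e₂ _ (P.map (mapRingHom (algebraMap k Ω)))
    (Associated.of_eq h)
  have := AdjoinRoot.isDomain_of_prime hP.prime
  exact (e₁.toRingEquiv.trans e₃).toMulEquiv.isDomain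

/-- If `R` is generated by `x` over the polynomial ring up to the denominator `δ`, the elements of
a finitely generated subspace of `R` have representations of bounded degree. -/
theorem exists_forall_exists_aeval_eq_smul {σ k R : Type*} [Field k] [CommRing R] [IsDomain R]
    [Algebra k R] [Algebra (MvPolynomial σ k) R] [IsScalarTower k (MvPolynomial σ k) R]
    {x : R} (hx : IsIntegral (MvPolynomial σ k) x)
    {δ : MvPolynomial σ k} (hδ : ∀ r : R, δ • r ∈ Algebra.adjoin (MvPolynomial σ k) {x})
    {V : Submodule k R} (hV : V.FG) :
    ∃ B : ℕ, ∀ v ∈ V, ∃ w : (MvPolynomial σ k)[X],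
      w.degree < (minpoly (MvPolynomial σ k) x).degree ∧
      (∀ j, (w.coeff j).totalDegree ≤ B) ∧ aeval x w = δ • v := by
  let T := MvPolynomial σ k
  have h1 : ∀ v : R, ∃ w : T[X], w.degree < (minpoly T x).degree ∧ aeval x w = δ • v := by
    intro v
    obtain ⟨w, hw⟩ := Algebra.adjoin_mem_exists_aeval _ _ (hδ v)
    refine ⟨w %ₘ minpoly T x, degree_modByMonic_lt _ (minpoly.monic hx), ?_⟩
    rw [aeval_modByMonic_eq_self_of_root (minpoly.aeval T x), hw]
  choose w hwdeg hw using h1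
  obtain ⟨s, rfl⟩ := hV
  refine ⟨s.sup fun v => (w v).support.sup fun j => ((w v).coeff j).totalDegree, fun v hv => ?_⟩
  set B := s.sup fun v => (w v).support.sup fun j => ((w v).coeff j).totalDegree
  induction hv using Submodule.span_induction with
  | mem v hv =>
    refine ⟨w v, hwdeg v, fun j => ?_, hw v⟩
    by_cases hj : j ∈ (w v).support
    · exact (Finset.le_sup (f := fun j => ((w v).coeff j).totalDegree) hj).trans
        (Finset.le_sup (f := fun v => (w v).support.sup fun j => ((w v).coeff j).totalDegree) hv)
    · rw [notMem_support_iff.1 hj]; simp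
  | zero =>
    refine ⟨0, ?_, by simp, by simp⟩
    rw [degree_zero, bot_lt_iff_ne_bot, degree_ne_bot]
    exact (minpoly.monic hx).ne_zero
  | add v v' _ _ hv hv' =>
    obtain ⟨a, ha1, ha2, ha3⟩ := hv
    obtain ⟨b, hb1, hb2, hb3⟩ := hv'
    refine ⟨a + b, (degree_add_le _ _).trans_lt (max_lt ha1 hb1), fun j => ?_, ?_⟩
    · rw [coeff_add]
      exact (MvPolynomial.totalDegree_add _ _).trans (max_le (ha2 j) (hb2 j))
    · rw [map_add, ha3, hb3, smul_add]
  | smul c v _ hv =>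
    obtain ⟨a, ha1, ha2, ha3⟩ := hv
    refine ⟨c • a, (degree_smul_le _ _).trans_lt ha1, fun j => ?_, ?_⟩
    · rw [coeff_smul]
      exact (MvPolynomial.totalDegree_smul_le _ _).trans (ha2 j)
    · rw [← AlgHom.coe_toLinearMap, LinearMap.map_smul_of_tower,
        AlgHom.coe_toLinearMap, ha3, smul_comm]

/-- Suppose that `R` is generated by `x` over `T` up to the denominator `δ`. A ring homomorphism
from `T` to a field in which `δ` does not vanish extends to `R` once a root of the image of the
minimal polynomial of `x` is chosen. -/
theorem exists_ringHom_of_forall_smul_mem_adjoin {T R E : Type*} [CommRing T] [IsDomain T]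
    [IsIntegrallyClosed T] [CommRing R] [IsDomain R] [Algebra T R] [FaithfulSMul T R] [Field E]
    {x : R} (hx : IsIntegral T x) {δ : T} (hδ : ∀ r : R, δ • r ∈ Algebra.adjoin T {x})
    {ψ : T →+* E} {y : E} (hy : (minpoly T x).eval₂ ψ y = 0) (hψδ : ψ δ ≠ 0) :
    ∃ φ : R →+* E, (∀ t, φ (algebraMap T R t) = ψ t) ∧
      ∀ (r : R) (w : T[X]), aeval x w = δ • r → w.eval₂ ψ y = ψ δ * φ r := by
  have key : ∀ w w' : T[X], aeval x w = aeval x w' → w.eval₂ ψ y = w'.eval₂ ψ y := by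
    intro w w' h
    obtain ⟨q, hq⟩ := minpoly.isIntegrallyClosed_dvd hx (p := w - w') (by rw [map_sub, h, sub_self])
    rw [← sub_eq_zero, ← eval₂_sub, hq, eval₂_mul, hy, zero_mul]
  choose w hw using fun r => Algebra.adjoin_mem_exists_aeval _ _ (hδ r)
  have hC : ∀ t : T, (w (algebraMap T R t)).eval₂ ψ y = ψ δ * ψ t := by
    intro t
    rw [key _ (C (δ * t)), eval₂_C, map_mul]
    rw [hw, aeval_C, map_mul, Algebra.smul_def]
  let φ : R →+* E :=
    { toFun := fun r => (ψ δ)⁻¹ * (w r).eval₂ ψ y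
      map_one' := by
        have := hC 1
        rw [map_one, map_one, mul_one] at this
        rw [this, inv_mul_cancel₀ hψδ]
      map_zero' := by
        have := hC 0
        rw [map_zero, map_zero, mul_zero] at this
        rw [this, mul_zero]
      map_add' := fun r s => by
        rw [← mul_add, ← eval₂_add]
        congr 1
        apply key
        rw [map_add, hw, hw, hw, smul_add]
      map_mul' := fun r s => by
        have h1 : ψ δ * (w (r * s)).eval₂ ψ y = (w r).eval₂ ψ y * (w s).eval₂ ψ y := by
          rw [← eval₂_mul, ← eval₂_C ψ y (a := δ), ← eval₂_mul]
          apply key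
          rw [map_mul, map_mul, hw, hw, hw, aeval_C]
          simp only [Algebra.smul_def]
          ring
        field_simp
        linear_combination h1 }
  refine ⟨φ, fun t => ?_, fun r w' hw' => ?_⟩
  · change (ψ δ)⁻¹ * _ = _
    rw [hC, inv_mul_cancel_left₀ hψδ]
  · change _ = ψ δ * ((ψ δ)⁻¹ * _)
    rw [mul_inv_cancel_left₀ hψδ]
    exact key _ _ (by rw [hw, hw'])

/-- Specialization of a geometrically integral algebra to a curve: a finitely generated
geometrically integral domain `R` over a field of characteristic zero maps to a geometrically
integral algebra that is finite over `k[X]`, injectively on any given finitely generated subspace.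
-/
theorem exists_algHom_finite_polynomial {k R : Type u} [Field k] [CharZero k] [CommRing R]
    [IsDomain R] [Algebra k R] [Algebra.FiniteType k R] [IsDomain (AlgebraicClosure k ⊗[k] R)]
    {V : Submodule k R} (hV : V.FG) :
    ∃ (A : Type u) (_ : CommRing A) (_ : Algebra k A) (φ : R →ₐ[k] A) (ι : k[X] →ₐ[k] A),
      (∀ v ∈ V, φ v = 0 → v = 0) ∧ Function.Injective ι ∧ ι.Finite ∧
      ∀ (Ω : Type u) [Field Ω] [Algebra k Ω], IsDomain (Ω ⊗[k] A) := by
  obtain ⟨n, g, hg, hgfin⟩ := exists_finite_inj_algHom_of_fg k R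
  let T := MvPolynomial (Fin n) k
  let _ : Algebra T R := g.toRingHom.toAlgebra
  have : IsScalarTower k T R := .of_algebraMap_eq fun a => (g.commutes a).symm
  have : Module.Finite T R := hgfin
  have : FaithfulSMul T R := (faithfulSMul_iff_algebraMap_injective _ _).2 hg
  obtain ⟨x, δ, hδ0, hδ⟩ := exists_smul_mem_adjoin_singleton T R
  have hx : IsIntegral T x := Algebra.IsIntegral.isIntegral x
  obtain ⟨B, hB⟩ := exists_forall_exists_aeval_eq_smul hx hδ hV
  obtain ⟨N, hN2, hN⟩ := MvPolynomial.exists_aeval_ne_zero_of_natDegree_eq k n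
    (max B δ.totalDegree + 1)
  obtain ⟨c, hc⟩ := exists_forall_irreducible_map_curveSubst.{0, u, u, u} (k := k) N x
  obtain ⟨f, hf0, hf⟩ := exists_forall_irreducible_specialization
    (((minpoly.monic hx).map (curveSubst N c).toRingHom)) hc
  obtain ⟨a, ha⟩ : ∃ a, MvPolynomial.eval a f ≠ 0 := by
    by_contra! h
    exact hf0 (MvPolynomial.funext fun a => by rw [h a, map_zero])
  -- the restriction of functions from affine space to the curve with parameter `a`
  let τ : Fin n → k[X] := fun i => C (a i) - X ^ N i - C (c i) * X
  have hτ : ∀ i, (τ i).natDegree = N i := by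
    intro i
    have hN := hN2 i
    have h1 : τ i = -(X ^ N i) + (C (a i) - C (c i) * X) := by simp only [τ]; ring
    have h2 : (C (a i) - C (c i) * X).natDegree < (-(X ^ N i) : k[X]).natDegree := by
      rw [natDegree_neg, natDegree_X_pow]
      refine lt_of_le_of_lt (natDegree_sub_le_of_le (m := 1) (n := 1) (by simp) ?_)
          (lt_of_lt_of_le ?_ hN)
      · exact (natDegree_C_mul_le _ _).trans natDegree_X_le
      · simp
    rw [h1, natDegree_add_eq_left_of_natDegree_lt h2, natDegree_neg, natDegree_X_pow]
  let ψ : T →ₐ[k] k[X] := MvPolynomial.aeval τ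
  have hψ : (mapRingHom (MvPolynomial.eval a)).comp (curveSubst N c).toRingHom = ψ.toRingHom := by
    refine MvPolynomial.ringHom_ext (fun b => ?_) fun i => ?_
    · refine Eq.trans ?_ (ψ.commutes b).symm
      simp [curveSubst]
    · refine Eq.trans ?_ (MvPolynomial.aeval_X τ i).symm
      simp [curveSubst, τ]
  have hψ0 : ∀ p : T, p ≠ 0 → p.totalDegree ≤ max B δ.totalDegree → ψ p ≠ 0 := fun p hp hpB =>
    hN τ hτ p hp fun i => Nat.lt_succ_of_le ((MvPolynomial.degreeOf_le_totalDegree _ _).trans hpB)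
  let P : k[X][X] := (minpoly T x).map ψ.toRingHom
  have hP : P.Monic := (minpoly.monic hx).map _
  have hPirr : ∀ (Ω : Type u) [Field Ω] [Algebra k Ω],
      Irreducible (P.map (mapRingHom (algebraMap k Ω))) := by
    intro Ω _ _
    have := hf a ha Ω
    rwa [← mapRingHom_comp, ← Polynomial.map_map, Polynomial.map_map (curveSubst N c).toRingHom,
      hψ] at this
  have hprime : Prime P := by
    have := hPirr k
    rw [Algebra.algebraMap_self, mapRingHom_id, Polynomial.map_id] at this
    exact this.prime
  -- the coordinate ring of the curve cut out by `P`
  let D := AdjoinRoot P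
  have hD : IsDomain D := AdjoinRoot.isDomain_of_prime hprime
  let E := FractionRing D
  have hofinj : Function.Injective (AdjoinRoot.of P) := by
    refine AdjoinRoot.of.injective_of_degree_ne_zero fun h => hprime.not_isUnit ?_
    rw [hP.degree_le_zero_iff_eq_one.1 h.le]
    exact isUnit_one
  let j : k[X] →+* E := (algebraMap D E).comp (AdjoinRoot.of P)
  have hj : Function.Injective j := (IsFractionRing.injective D E).comp hofinj
  have hψδ : j (ψ δ) ≠ 0 := (map_ne_zero_iff j hj).2 (hψ0 δ hδ0 (le_max_right _ _))
  obtain ⟨φ, hφT, hφ⟩ := exists_ringHom_of_forall_smul_mem_adjoin hx hδ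
    (ψ := j.comp ψ.toRingHom) (y := algebraMap D E (AdjoinRoot.root P)) (by
      rw [← eval₂_map, ← hom_eval₂, AdjoinRoot.eval₂_root, map_zero]) hψδ
  -- elements of `V` have representations of bounded degree, which restriction does not kill
  have hV0 : ∀ v ∈ V, φ v = 0 → v = 0 := by
    intro v hv hv0
    obtain ⟨w, hw1, hw2, hw3⟩ := hB v hv
    have h1 := hφ v w hw3
    rw [hv0, mul_zero, ← eval₂_map, ← hom_eval₂, ← AdjoinRoot.algebraMap_eq, ← aeval_def,
      AdjoinRoot.aeval_eq, map_eq_zero_iff _ (IsFractionRing.injective D E), AdjoinRoot.mk_eq_zero]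
      at h1
    have h2 : w.map ψ.toRingHom = 0 := by
      refine eq_zero_of_dvd_of_degree_lt h1 (degree_map_le.trans_lt ?_)
      rwa [(minpoly.monic hx).degree_map]
    have h3 : w = 0 := by
      ext1 i
      by_contra h
      refine hψ0 (w.coeff i) h ((hw2 i).trans (le_max_left _ _)) ?_
      have := congrArg (fun p => coeff p i) h2
      simpa using this
    rw [h3, map_zero] at hw3
    exact (smul_eq_zero.1 hw3.symm).resolve_left hδ0
  obtain ⟨s, hs⟩ := ‹Algebra.FiniteType k R›
  let φ' : R →ₐ[k] E := AlgHom.mk φ fun b => by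
    refine (congrArg φ (IsScalarTower.algebraMap_apply k T R b)).trans ((hφT _).trans ?_)
    change j (ψ (algebraMap k T b)) = _
    rw [ψ.commutes]
    rfl
  -- `A` has to be finite over `k[X]`, so it is generated by the image of `R`, not by `D`
  let A := Algebra.adjoin k[X] (φ' '' s)
  have hA : ∀ r, φ' r ∈ A.restrictScalars k := by
    have h1 : Algebra.adjoin k (φ' '' s) ≤ A.restrictScalars k :=
      Algebra.adjoin_le (Algebra.subset_adjoin (R := k[X]))
    rw [← AlgHom.map_adjoin, hs] at h1
    exact fun r => h1 ⟨r, trivial, rfl⟩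
  let φA : R →ₐ[k] A.restrictScalars k := φ'.codRestrict _ hA
  have hfin : Module.Finite k[X] A := by
    refine Algebra.finite_adjoin_of_finite_of_isIntegral (s.finite_toSet.image _) ?_
    rintro _ ⟨r, -, rfl⟩
    exact (Algebra.IsIntegral.isIntegral (R := T) r).map_of_comp_eq ψ.toRingHom φ
      (RingHom.ext fun t => (hφT t).symm)
  refine ⟨A, inferInstance, inferInstance, φA, IsScalarTower.toAlgHom k k[X] A,
      fun v hv h => ?_, ?_, ?_, ?_⟩
  · exact hV0 v hv (congrArg Subtype.val h)
  · exact fun p q h => hj (congrArg Subtype.val h)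
  · exact (RingHom.finite_algebraMap (A := k[X]) (B := A)).2 hfin
  · intro Ω _ _
    have h1 : IsDomain (Ω ⊗[k] D) := AdjoinRoot.isDomain_tensorProduct (hPirr Ω)
    have h2 : IsDomain (Ω ⊗[k] E) := TensorProduct.isDomain_of_isFractionRing (D := D)
    exact (Module.Flat.lTensor_preserves_injective_linearMap (M := Ω)
      (A.restrictScalars k).val.toLinearMap Subtype.val_injective).isDomain
        (Algebra.TensorProduct.map (AlgHom.id k Ω) (A.restrictScalars k).val)

end

/-! ### Coordinates and eigenvalues in finite extensions -/

section

open Polynomial TensorProduct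

/-- Coordinates of a finite extension `R ⊆ B` of domains with respect to a basis of fraction
fields, up to a denominator `r`. -/
theorem exists_coordinates_of_finite (R B : Type*) [CommRing R] [IsDomain R] [CommRing B]
    [IsDomain B] [Algebra R B] [Module.Finite R B] [FaithfulSMul R B] :
    ∃ (r : R) (e : Fin (Module.finrank R B) → B) (s : B →ₗ[R] (Fin (Module.finrank R B) → R)),
      r ≠ 0 ∧ (∀ i, s (e i) = Pi.single i r) ∧ ∀ x, ∑ i, s x i • e i = r • x := by
  let K := FractionRing R
  let E := FractionRing B
  let _ : Algebra K E := FractionRing.liftAlgebra R E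
  have : IsScalarTower R K E := FractionRing.isScalarTower_liftAlgebra R E
  have : IsLocalization (Algebra.algebraMapSubmonoid B (nonZeroDivisors R)) E := inferInstance
  have : FiniteDimensional K E := .of_isLocalization R B (nonZeroDivisors R)
  have hrank : Module.finrank R B = Module.finrank K E :=
    (IsFractionRing.finrank_eq R K B E).symm
  rw [hrank]
  set N := Module.finrank K E
  let b₀ := Module.finBasis K E
  have h1 : ∀ i, ∃ x : B, ∃ d : R, d ≠ 0 ∧ algebraMap B E x = algebraMap R K d • b₀ i := by
    intro i
    obtain ⟨⟨x, ⟨_, d, hd, rfl⟩⟩, hx⟩ := IsLocalization.surj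
      (Algebra.algebraMapSubmonoid B (nonZeroDivisors R)) (b₀ i)
    refine ⟨x, d, nonZeroDivisors.ne_zero hd, ?_⟩
    rw [← hx, Algebra.smul_def, mul_comm, ← IsScalarTower.algebraMap_apply,
      ← IsScalarTower.algebraMap_apply]
  choose e d hd he using h1
  have hd' : ∀ i, algebraMap R K (d i) ≠ 0 := fun i => by simpa using hd i
  let b₁ := b₀.isUnitSMul (fun i => (hd' i).isUnit)
  have hb₁ : ∀ i, b₁ i = algebraMap B E (e i) := fun i => by
    rw [he, Module.Basis.isUnitSMul_apply]
  classical
  obtain ⟨t, ht⟩ := Module.Finite.fg_top (R := R) (M := B)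
  obtain ⟨⟨r, hr⟩, hr'⟩ := IsLocalization.exist_integer_multiples_of_finset (nonZeroDivisors R)
    (S := K) (Finset.image (fun p : B × Fin N => b₁.repr (algebraMap B E p.1) p.2)
      (t ×ˢ Finset.univ))
  have hint : ∀ (x : B) (i : Fin N), ∃ a : R,
      algebraMap R K a = algebraMap R K r * b₁.repr (algebraMap B E x) i := by
    intro x i
    have hx : x ∈ Submodule.span R (t : Set B) := ht ▸ Submodule.mem_top
    induction hx using Submodule.span_induction with
    | mem y hy =>
      obtain ⟨a, ha⟩ := hr' (b₁.repr (algebraMap B E y) i)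
        (Finset.mem_image.2 ⟨(y, i), by simpa using hy, rfl⟩)
      exact ⟨a, by rw [ha, Algebra.smul_def]⟩
    | zero => exact ⟨0, by simp⟩
    | add y z _ _ hy hz =>
      obtain ⟨a, ha⟩ := hy
      obtain ⟨c, hc⟩ := hz
      exact ⟨a + c, by simp [ha, hc, mul_add]⟩
    | smul c y _ hy =>
      obtain ⟨a, ha⟩ := hy
      refine ⟨c * a, ?_⟩
      have : algebraMap B E (c • y) = algebraMap R K c • algebraMap B E y := by
        rw [Algebra.smul_def, map_mul, ← IsScalarTower.algebraMap_apply,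
          IsScalarTower.algebraMap_apply R K E, Algebra.smul_def]
      rw [this, map_smul, Finsupp.smul_apply, map_mul, ha, smul_eq_mul]
      ring
  choose s hs using hint
  have hinj := IsFractionRing.injective R K
  refine ⟨r, e, ⟨⟨fun x i => s x i, fun x y => ?_⟩, fun c x => ?_⟩, nonZeroDivisors.ne_zero hr,
    fun i => ?_, fun x => ?_⟩
  · ext i
    apply hinj
    simp [hs, mul_add]
  · ext i
    apply hinj
    have : algebraMap B E (c • x) = algebraMap R K c • algebraMap B E x := by
      rw [Algebra.smul_def, map_mul, ← IsScalarTower.algebraMap_apply,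
        IsScalarTower.algebraMap_apply R K E, Algebra.smul_def]
    simp only [hs, this, map_smul, Finsupp.smul_apply, Pi.smul_apply, smul_eq_mul, map_mul,
      RingHom.id_apply]
    ring
  · ext j
    apply hinj
    change algebraMap R K (s (e i) j) = _
    rw [hs, ← hb₁, b₁.repr_self, Finsupp.single_apply, Pi.single_apply]
    by_cases h : i = j
    · simp [h]
    · simp [h, Ne.symm h]
  · apply IsFractionRing.injective B E
    change algebraMap B E (∑ i, s x i • e i) = _
    have h2 := b₁.sum_repr (algebraMap B E x)
    have h3 : ∀ (c : R) (y : B), algebraMap B E (c • y) = algebraMap R K c • algebraMap B E y := by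
      intro c y
      rw [Algebra.smul_def, map_mul, ← IsScalarTower.algebraMap_apply,
        IsScalarTower.algebraMap_apply R K E, Algebra.smul_def]
    rw [map_sum, h3, ← h2, Finset.smul_sum]
    refine Finset.sum_congr rfl fun i _ => ?_
    rw [h3, hs, hb₁, mul_smul]

/-- Let `s` be a coordinate map for `B` up to the denominator `r`, and let `b` act through the
matrix `M` in these coordinates. A root `ω` of the characteristic polynomial of a specialization of
`M` in which `r` does not vanish is the value of `b` under a homomorphism on `B`: pairing
coordinates with a left eigenvector gives a nonzero functional on `κ ⊗ B` that vanishes on the ideal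
generated by `b - ω`, so this ideal is contained in a maximal one. -/
theorem exists_algHom_eq_of_isRoot_charpoly {R B κ ι : Type*} [CommRing R] [CommRing B]
    [Algebra R B] [Module.Finite R B] [Field κ] [IsAlgClosed κ] [Algebra R κ] [Fintype ι]
    [DecidableEq ι] {r : R} {e : ι → B} {s : B →ₗ[R] (ι → R)} (hs : ∀ i, s (e i) = Pi.single i r)
    (hr : algebraMap R κ r ≠ 0) {M : Matrix ι ι R} {b : B} (hM : ∀ x, s (b * x) = M.mulVec (s x))
    {ω : κ} (hω : (M.map (algebraMap R κ)).charpoly.IsRoot ω) :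
    ∃ β : B →ₐ[R] κ, β b = ω := by
  rw [IsRoot.def, Matrix.eval_charpoly] at hω
  obtain ⟨v, hv0, hv⟩ := Matrix.exists_vecMul_eq_zero_iff.2 hω
  have hv' : Matrix.vecMul v (M.map (algebraMap R κ)) = ω • v := by
    rw [Matrix.vecMul_sub, sub_eq_zero] at hv
    rw [← hv, Matrix.scalar_apply]
    ext i
    rw [Matrix.vecMul_diagonal, Pi.smul_apply, smul_eq_mul, mul_comm]
  let Λ₀ : B →ₗ[R] κ :=
    { toFun := fun x => v ⬝ᵥ (algebraMap R κ ∘ s x)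
      map_add' := fun x y => by
        rw [← dotProduct_add]
        congr 1
        ext i
        simp
      map_smul' := fun c x => by
        rw [RingHom.id_apply, ← dotProduct_smul]
        congr 1
        ext i
        rw [map_smul, Function.comp_apply, Pi.smul_apply, Pi.smul_apply, Function.comp_apply,
          smul_eq_mul, map_mul, Algebra.smul_def] }
  have hΛ₀ : ∀ x, Λ₀ (b * x) = ω * Λ₀ x := by
    intro x
    change v ⬝ᵥ (algebraMap R κ ∘ s (b * x)) = ω * v ⬝ᵥ (algebraMap R κ ∘ s x)
    rw [hM, ← smul_eq_mul, ← smul_dotProduct, ← hv', ← Matrix.dotProduct_mulVec]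
    congr 1
    ext i
    exact RingHom.map_mulVec (algebraMap R κ) M (s x) i
  let Λ : κ ⊗[R] B →ₗ[κ] κ := Λ₀.liftBaseChange κ
  have hΛ : ∀ c x, Λ (c ⊗ₜ x) = c * Λ₀ x := fun c x => by simp [Λ]
  let ε : κ ⊗[R] B := 1 ⊗ₜ b - ω ⊗ₜ 1
  have hε : ∀ z, Λ (z * ε) = 0 := by
    intro z
    induction z with
    | zero => simp
    | tmul c x =>
      simp only [ε, mul_sub, Algebra.TensorProduct.tmul_mul_tmul, map_sub, hΛ, mul_one]
      rw [mul_comm x b, hΛ₀]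
      ring
    | add x y hx hy => rw [add_mul, map_add, hx, hy, add_zero]
  have hJ : Ideal.span {ε} ≠ ⊤ := by
    intro h
    obtain ⟨i, hi⟩ := Function.ne_iff.1 hv0
    have h1 : (1 ⊗ₜ e i : κ ⊗[R] B) ∈ Ideal.span {ε} := h ▸ trivial
    obtain ⟨z, hz⟩ := Ideal.mem_span_singleton'.1 h1
    have h2 := hε z
    rw [hz, hΛ, one_mul] at h2
    have h3 : Λ₀ (e i) = v i * algebraMap R κ r := by
      change v ⬝ᵥ (algebraMap R κ ∘ s (e i)) = _
      rw [hs, dotProduct, Finset.sum_eq_single i]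
      · simp
      · intro j _ hj
        simp [hj]
      · simp
    rw [h3] at h2
    exact (mul_ne_zero hi hr) h2
  obtain ⟨m, hm, hJm⟩ := Ideal.exists_le_maximal _ hJ
  let _ : Field ((κ ⊗[R] B) ⧸ m) := Ideal.Quotient.field m
  have : Module.Finite κ ((κ ⊗[R] B) ⧸ m) := inferInstance
  let ℓ : (κ ⊗[R] B) ⧸ m →ₐ[κ] κ := IsAlgClosed.lift
  let π : κ ⊗[R] B →ₐ[κ] κ := ℓ.comp (Ideal.Quotient.mkₐ κ m)
  refine ⟨(π.restrictScalars R).comp Algebra.TensorProduct.includeRight, ?_⟩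
  have h1 : π ε = 0 := by
    have : Ideal.Quotient.mkₐ κ m ε = 0 :=
      Ideal.Quotient.eq_zero_iff_mem.2 (hJm (Ideal.mem_span_singleton_self ε))
    change ℓ (Ideal.Quotient.mkₐ κ m ε) = 0
    rw [this, map_zero]
  have h2 : π (ω ⊗ₜ 1) = ω := π.commutes ω
  rw [map_sub, h2, sub_eq_zero] at h1
  exact h1

/-- If the roots of a monic polynomial, divided by `ρ`, lie in a subfield, then so do the
correspondingly rescaled coefficients. -/
theorem Polynomial.coeff_div_pow_mem_range_of_roots {L κ : Type*} [Field L] [Field κ]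
    [IsAlgClosed κ] [Algebra L κ] {p : κ[X]} (hp : p.Monic) {ρ : κ} (hρ : ρ ≠ 0)
    (h : ∀ ω, p.IsRoot ω → ω / ρ ∈ Set.range (algebraMap L κ)) (i : ℕ) :
    p.coeff i / ρ ^ (p.natDegree - i) ∈ Set.range (algebraMap L κ) := by
  have hq : (p.scaleRoots ρ⁻¹).Monic := (monic_scaleRoots_iff _).2 hp
  have h1 : p.scaleRoots ρ⁻¹ ∈ lifts (algebraMap L κ) := by
    rw [(IsAlgClosed.splits (p.scaleRoots ρ⁻¹)).eq_prod_roots_of_monic hq,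
      roots_scaleRoots _ (inv_ne_zero hρ).isUnit]
    refine Subsemiring.multiset_prod_mem _ _ fun f hf => ?_
    simp only [Multiset.map_map, Multiset.mem_map, Function.comp_apply] at hf
    obtain ⟨ω, hω, rfl⟩ := hf
    obtain ⟨l, hl⟩ := h ω (isRoot_of_mem_roots hω)
    refine ⟨X - C l, ?_⟩
    simp [hl, div_eq_inv_mul]
  obtain ⟨l, hl⟩ := (lifts_iff_coeff_lifts _).1 h1 i
  refine ⟨l, ?_⟩
  rw [hl, coeff_scaleRoots, inv_pow, div_eq_mul_inv]

end

/-! ### Specialization of a finite extension -/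

section

open Polynomial TensorProduct

/-- Over an algebraically closed field, an element of a field extension that is not a scalar is
transcendental. -/
theorem IsAlgClosed.transcendental_of_notMem_range {L κ : Type*} [Field L] [IsAlgClosed L] [Field κ]
    [Algebra L κ] {x : κ} (hx : x ∉ Set.range (algebraMap L κ)) : Transcendental L x := by
  intro h
  exact hx (minpoly.mem_range_of_degree_eq_one L x
    (IsAlgClosed.degree_eq_one_of_irreducible L (minpoly.irreducible h.isIntegral)))

/-- Finitely many elements of `L ⊗ R₀` are defined over a finitely generated subspace of `R₀`. -/
theorem TensorProduct.exists_fg_forall_mem_range_baseChange {k L R₀ : Type*} [Field k] [Field L]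
    [Algebra k L] [AddCommGroup R₀] [Module k R₀] (s : Finset (L ⊗[k] R₀)) :
    ∃ V : Submodule k R₀, V.FG ∧ ∀ y ∈ s, y ∈ LinearMap.range (V.subtype.baseChange L) := by
  obtain ⟨V, hV, h⟩ := exists_finite_submodule_right_of_setFinite (s : Set (L ⊗[k] R₀))
    s.finite_toSet
  exact ⟨V, Module.Finite.iff_fg.1 hV, fun y hy => h hy⟩

/-- A map that is injective on `V` remains so after extension of scalars. -/
theorem TensorProduct.eq_zero_of_mem_range_baseChange {k L R₀ A₀ : Type*} [Field k] [Field L]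
    [Algebra k L] [AddCommGroup R₀] [Module k R₀] [AddCommGroup A₀] [Module k A₀]
    {φ : R₀ →ₗ[k] A₀} {V : Submodule k R₀} (hV : ∀ v ∈ V, φ v = 0 → v = 0) {y : L ⊗[k] R₀}
    (hy : y ∈ LinearMap.range (V.subtype.baseChange L)) (h : φ.baseChange L y = 0) : y = 0 := by
  obtain ⟨z, rfl⟩ := hy
  have hinj : Function.Injective ((φ ∘ₗ V.subtype).lTensor L) := by
    refine Module.Flat.lTensor_preserves_injective_linearMap _ ?_
    rw [← LinearMap.ker_eq_bot, LinearMap.ker_eq_bot']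
    exact fun v hv => Subtype.ext (hV v v.2 hv)
  have h1 : ((φ ∘ₗ V.subtype).lTensor L) z = 0 := by
    rw [LinearMap.lTensor_comp]
    exact h
  rw [hinj (h1.trans (map_zero _).symm), map_zero]

/-- If `b` acts on `B` through the matrix `M` then it is a root of the characteristic polynomial
of `M`. -/
theorem aeval_charpoly_eq_zero_of_coordinates {R B ι : Type*} [CommRing R] [CommRing B] [IsDomain B]
    [Algebra R B] [FaithfulSMul R B] [Fintype ι] [DecidableEq ι] {r : R} (hr : r ≠ 0) {e : ι → B}
    {s : B →ₗ[R] (ι → R)} (hs : ∀ x, ∑ i, s x i • e i = r • x) {M : Matrix ι ι R} {b : B}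
    (hM : ∀ x, s (b * x) = M.mulVec (s x)) : aeval b M.charpoly = 0 := by
  have key : ∀ (p : R[X]) x, s (aeval b p * x) = (aeval M p).mulVec (s x) := by
    intro p
    induction p using Polynomial.induction_on' with
    | add p q hp hq =>
      intro x
      rw [map_add, add_mul, map_add, hp, hq, map_add, Matrix.add_mulVec]
    | monomial n a =>
      have h1 : ∀ n x, s (b ^ n * x) = (M ^ n).mulVec (s x) := by
        intro n
        induction n with
        | zero => simp
        | succ n ih =>
          intro x
          rw [pow_succ, mul_assoc, ih, hM, Matrix.mulVec_mulVec, ← pow_succ]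
      intro x
      rw [aeval_monomial, aeval_monomial, ← Algebra.smul_def, ← Algebra.smul_def, smul_mul_assoc,
        map_smul, h1, Matrix.smul_mulVec]
  have h1 := key M.charpoly 1
  rw [Matrix.aeval_self_charpoly, Matrix.zero_mulVec, mul_one] at h1
  have h2 := hs (aeval b M.charpoly)
  rw [h1] at h2
  simp only [Pi.zero_apply, zero_smul, Finset.sum_const_zero] at h2
  rw [eq_comm, Algebra.smul_def, mul_eq_zero] at h2
  refine h2.resolve_left fun h => hr ?_
  exact FaithfulSMul.algebraMap_injective R B (by rw [h, map_zero])

/-- If `b / ρ` is transcendental over `L`, some coefficient of the characteristic polynomial of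
`b`, rescaled by a power of `ρ`, is not in `L`. -/
theorem exists_forall_coeff_charpoly_ne {L R B E ι : Type*} [Field L]
    [CommRing R] [IsDomain R] [CommRing B]
    [IsDomain B] [Algebra L R] [Algebra R B] [Field E] [Algebra L E] [Algebra B E]
    [FaithfulSMul B E] [Fintype ι] [DecidableEq ι]
    (hLE : ∀ l : L, algebraMap L E l = algebraMap B E (algebraMap R B (algebraMap L R l)))
    {M : Matrix ι ι R} {b : B} (hb : aeval b M.charpoly = 0) {ρ : R}
    (hρ : algebraMap B E (algebraMap R B ρ) ≠ 0)
    (ht : Transcendental L (algebraMap B E b / algebraMap B E (algebraMap R B ρ))) :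
    ∃ i, ∀ l : L, M.charpoly.coeff i ≠ algebraMap L R l * ρ ^ (Fintype.card ι - i) := by
  by_contra! h
  choose l hl using h
  set N := Fintype.card ι
  apply ht
  have hN : M.charpoly.natDegree = N := M.charpoly_natDegree_eq_dim
  refine ⟨∑ i ∈ Finset.range (N + 1), C (l i) * X ^ i, fun h0 => ?_, ?_⟩
  · have h1 := congrArg (fun p => coeff p N) h0
    simp only [finsetSum_coeff, coeff_C_mul_X_pow, coeff_zero] at h1
    rw [Finset.sum_ite_eq, if_pos (Finset.self_mem_range_succ N)] at h1
    have h2 := hl N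
    rw [h1, map_zero, zero_mul, ← hN, M.charpoly_monic.coeff_natDegree] at h2
    exact one_ne_zero h2
  · set ρE := algebraMap B E (algebraMap R B ρ) with hρE
    have h1 := congrArg (algebraMap B E) hb
    rw [aeval_eq_sum_range, hN, map_zero, map_sum] at h1
    rw [map_sum, ← mul_right_inj' (pow_ne_zero N hρ), mul_zero, ← h1, Finset.mul_sum]
    refine Finset.sum_congr rfl fun i hi => ?_
    have hi' : N = (N - i) + i := by have := Finset.mem_range.1 hi; omega
    rw [hl, map_mul, aeval_C, map_pow, aeval_X, hLE, Algebra.smul_def, map_mul, map_mul, map_mul,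
      map_pow, map_pow, map_pow, div_pow]
    nth_rewrite 1 [hi']
    rw [pow_add]
    field_simp
    rw [← hρE]
    ring

/-- Let `B` be a finite extension of `L ⊗ R₀` and let `b / h` be transcendental over the
algebraically closed field `L`. Then `R₀` specializes to a geometrically integral algebra `A₀` of
dimension one in such a way that `B` specializes to a finite extension `B'` of `L ⊗ A₀`, of no
larger degree, in which `b / h` remains transcendental. -/
theorem exists_specialization_finite_polynomial {k L R₀ B : Type u} [Field k] [CharZero k] [Field L]
    [IsAlgClosed L] [Algebra k L] [CommRing R₀] [IsDomain R₀] [Algebra k R₀]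
    [Algebra.FiniteType k R₀] [IsDomain (AlgebraicClosure k ⊗[k] R₀)] [IsDomain (L ⊗[k] R₀)]
    [CommRing B] [IsDomain B] [Algebra (L ⊗[k] R₀) B] [Algebra L B] [IsScalarTower L (L ⊗[k] R₀) B]
    [Module.Finite (L ⊗[k] R₀) B] [FaithfulSMul (L ⊗[k] R₀) B] {b h : B} (hh : h ≠ 0)
    (hbh : Transcendental L
      (algebraMap B (FractionRing B) b / algebraMap B (FractionRing B) h)) :
    ∃ (A₀ : Type u) (_ : CommRing A₀) (_ : Algebra k A₀) (ι : k[X] →ₐ[k] A₀),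
      Function.Injective ι ∧ ι.Finite ∧
      (∀ (Ω : Type u) [Field Ω] [Algebra k Ω], IsDomain (Ω ⊗[k] A₀)) ∧
      ∃ (φ : R₀ →ₐ[k] A₀) (B' : Type u) (_ : CommRing B') (_ : IsDomain B')
        (_ : Algebra (L ⊗[k] A₀) B') (β : B →+* B'),
        Module.Finite (L ⊗[k] A₀) B' ∧ FaithfulSMul (L ⊗[k] A₀) B' ∧
        (∀ x, β (algebraMap (L ⊗[k] R₀) B x) =
          algebraMap (L ⊗[k] A₀) B' (Algebra.TensorProduct.map (AlgHom.id L L) φ x)) ∧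
        Module.finrank (L ⊗[k] A₀) B' ≤ Module.finrank (L ⊗[k] R₀) B ∧ β h ≠ 0 ∧
        ∀ p : L[X], p ≠ 0 → p.eval₂ ((algebraMap B' (FractionRing B')).comp
            ((algebraMap (L ⊗[k] A₀) B').comp (algebraMap L (L ⊗[k] A₀))))
          (algebraMap B' (FractionRing B') (β b) / algebraMap B' (FractionRing B') (β h)) ≠ 0 := by
  let R := L ⊗[k] R₀
  obtain ⟨N, hN, r, e, s, hr, hse, hs⟩ : ∃ N, N = Module.finrank R B ∧
      ∃ (r : R) (e : Fin N → B) (s : B →ₗ[R] (Fin N → R)),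
        r ≠ 0 ∧ (∀ i, s (e i) = Pi.single i r) ∧ ∀ x, ∑ i, s x i • e i = r • x :=
    ⟨_, rfl, exists_coordinates_of_finite R B⟩
  obtain ⟨ρ, hρ, h', hρh⟩ :=
      (Algebra.IsIntegral.isIntegral (R := R) h).isAlgebraic.exists_nonzero_dvd
    (mem_nonZeroDivisors_of_ne_zero hh)
  -- `b / h = b₂ / ρ₂` with `ρ₂` in `R` and `b₂` acting through a matrix over `R`
  let b₂ : B := r • (b * h')
  let ρ₂ : R := r * ρ
  have hρ₂ : ρ₂ ≠ 0 := mul_ne_zero hr hρ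
  let M : Matrix (Fin N) (Fin N) R := Matrix.of fun i j => s (b * h' * e j) i
  have hM : ∀ x, s (b₂ * x) = M.mulVec (s x) := by
    intro x
    have h1 : b₂ * x = ∑ j, s x j • (b * h' * e j) := by
      simp only [← mul_smul_comm, ← Finset.mul_sum]
      rw [hs, mul_smul_comm, ← smul_mul_assoc]
    rw [h1, map_sum]
    ext i
    simp only [map_smul, Finset.sum_apply, Pi.smul_apply, smul_eq_mul, Matrix.mulVec, dotProduct]
    exact Finset.sum_congr rfl fun j _ => mul_comm _ _
  let E := FractionRing B
  have hRB : Function.Injective (algebraMap R B) := FaithfulSMul.algebraMap_injective R B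
  have hBE := IsFractionRing.injective B E
  have hquot : ∀ {F : Type u} [Field F] (γ : B →+* F), γ (algebraMap R B ρ₂) ≠ 0 →
      γ h ≠ 0 ∧ γ b / γ h = γ b₂ / γ (algebraMap R B ρ₂) := by
    intro F _ γ hγ
    simp only [ρ₂, map_mul, hρh] at hγ ⊢
    simp only [b₂, Algebra.smul_def, map_mul]
    have h1 : γ h ≠ 0 := by aesop
    have h2 : γ h' ≠ 0 := by aesop
    have h3 : γ (algebraMap R B r) ≠ 0 := by aesop
    refine ⟨h1, ?_⟩
    field_simp
  have hρE : algebraMap B E (algebraMap R B ρ₂) ≠ 0 := by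
    rw [Ne, map_eq_zero_iff _ hBE, map_eq_zero_iff _ hRB]
    exact hρ₂
  rw [(hquot (algebraMap B E) hρE).2] at hbh
  obtain ⟨i, hi⟩ := exists_forall_coeff_charpoly_ne (L := L)
    (fun l => by
      rw [← IsScalarTower.algebraMap_apply L R B]
      exact IsScalarTower.algebraMap_apply L B E l)
    (aeval_charpoly_eq_zero_of_coordinates hr hs hM) hρE hbh
  rw [Fintype.card_fin] at hi
  classical
  -- specialize so that `r`, `ρ₂` stay nonzero and the `i`-th coefficient is still not a scalar
  -- multiple of `ρ₂ ^ (N - i)`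
  obtain ⟨V, hV, hVs⟩ := TensorProduct.exists_fg_forall_mem_range_baseChange (k := k) (L := L)
    {r, ρ₂, M.charpoly.coeff i, ρ₂ ^ (N - i)}
  obtain ⟨A₀, _, _, φ, ι, hφ, hι, hιfin, hdom⟩ := exists_algHom_finite_polynomial hV
  refine ⟨A₀, inferInstance, inferInstance, ι, hι, hιfin, hdom, φ, ?_⟩
  have hdomA := hdom L
  let A := L ⊗[k] A₀
  let Φ : R →ₐ[L] A := Algebra.TensorProduct.map (AlgHom.id L L) φ
  have hΦ : ∀ y ∈ LinearMap.range (V.subtype.baseChange L), Φ y = 0 → y = 0 := fun y hy h0 =>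
    TensorProduct.eq_zero_of_mem_range_baseChange (φ := φ.toLinearMap) hφ hy h0
  let _ : Algebra R A := Φ.toRingHom.toAlgebra
  let κ := AlgebraicClosure (FractionRing A)
  have hAκ : Function.Injective (algebraMap A κ) := by
    rw [IsScalarTower.algebraMap_eq A (FractionRing A) κ]
    exact (algebraMap (FractionRing A) κ).injective.comp (IsFractionRing.injective A _)
  have hrκ : algebraMap R κ r ≠ 0 := fun h0 =>
    hr (hΦ r (hVs _ (by simp)) ((map_eq_zero_iff _ hAκ).1 h0))
  have hρκ : algebraMap R κ ρ₂ ≠ 0 := fun h0 =>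
    hρ₂ (hΦ ρ₂ (hVs _ (by simp)) ((map_eq_zero_iff _ hAκ).1 h0))
  -- if all eigenvalues, divided by `ρ₂`, were in `L`, so would be the rescaled coefficient
  obtain ⟨ω, hω, hωL⟩ : ∃ ω, (M.map (algebraMap R κ)).charpoly.IsRoot ω ∧
      ω / algebraMap R κ ρ₂ ∉ Set.range (algebraMap L κ) := by
    by_contra! hcon
    obtain ⟨l, hl⟩ := coeff_div_pow_mem_range_of_roots (L := L) (Matrix.charpoly_monic _) hρκ hcon i
    rw [Matrix.charpoly_natDegree_eq_dim, Fintype.card_fin, Matrix.charpoly_map, coeff_map,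
      eq_div_iff (pow_ne_zero _ hρκ)] at hl
    refine hi l (sub_eq_zero.1 (hΦ _ ?_ ?_))
    · rw [← Algebra.smul_def]
      exact sub_mem (hVs _ (by simp)) (Submodule.smul_mem _ _ (hVs _ (by simp)))
    · refine (map_eq_zero_iff _ hAκ).1 ?_
      rw [map_sub, map_sub, map_mul, map_mul, map_pow, map_pow, AlgHom.commutes,
        ← IsScalarTower.algebraMap_apply L A κ]
      exact sub_eq_zero.2 hl.symm
  obtain ⟨β₀, hβ₀⟩ := exists_algHom_eq_of_isRoot_charpoly hse hrκ hM hω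
  have hβρ : β₀.toRingHom (algebraMap R B ρ₂) = algebraMap R κ ρ₂ := β₀.commutes ρ₂
  have hq := hquot β₀.toRingHom (by rw [hβρ]; exact hρκ)
  let ψ : A ⊗[R] B →ₐ[A] κ := Algebra.TensorProduct.lift (Algebra.ofId A κ) β₀ fun _ _ => .all _ _
  let B' := ψ.range
  have hβ' : ∀ x, β₀ x ∈ ψ.range := fun x => ⟨1 ⊗ₜ x, by simp [ψ]⟩
  let β : B →+* B' := β₀.toRingHom.codRestrict _ hβ'
  have hcoe : ∀ x, (β x : κ) = β₀ x := fun _ => rfl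
  refine ⟨B', inferInstance, inferInstance, inferInstance, β, ?_, ?_, fun x => ?_, ?_, ?_, ?_⟩
  · exact Module.Finite.of_surjective ψ.rangeRestrict.toLinearMap ψ.rangeRestrict_surjective
  · refine (faithfulSMul_iff_algebraMap_injective _ _).2 fun x y hxy => hAκ ?_
    exact congrArg Subtype.val hxy
  · exact Subtype.ext (β₀.commutes x)
  · -- up to the denominator `Φ r`, the algebra `B'` is spanned by the images of the `e i`
    let S := Submodule.span A (Set.range fun i => β (e i))
    have hβsmul : ∀ (c : R) (y : B), β (c • y) = Φ c • β y := fun c y => Subtype.ext <| by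
      rw [hcoe, map_smul]
      change c • β₀ y = Φ c • β₀ y
      rw [Algebra.smul_def, Algebra.smul_def]
      rfl
    have hS : ∀ x : B', Φ r • x ∈ S := by
      intro x
      obtain ⟨z, rfl⟩ := ψ.rangeRestrict_surjective x
      induction z with
      | zero => simp
      | tmul a x =>
        have h1 : ψ.rangeRestrict (a ⊗ₜ x) = a • β x := Subtype.ext <| by
          change ψ (a ⊗ₜ x) = a • β₀ x
          rw [Algebra.TensorProduct.lift_tmul, Algebra.smul_def]
          rfl
        rw [h1, smul_comm, ← hβsmul, ← hs, map_sum]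
        refine Submodule.smul_mem _ _ (Submodule.sum_mem _ fun i _ => ?_)
        rw [hβsmul]
        exact Submodule.smul_mem _ _ (Submodule.subset_span ⟨i, rfl⟩)
      | add x y hx hy =>
        rw [map_add, smul_add]
        exact add_mem hx hy
    have hSfin : Module.Finite A S := Module.Finite.span_of_finite A (Set.finite_range _)
    have hΦr : Φ r ≠ 0 := fun h0 => hr (hΦ r (hVs _ (by simp)) h0)
    let mulr : B' →ₗ[A] S := (LinearMap.lsmul A B' (Φ r)).codRestrict S hS
    have hmulr : Function.Injective mulr := by
      intro x y hxy
      have h1 : Φ r • x = Φ r • y := congrArg Subtype.val hxy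
      have h2 : algebraMap A κ (Φ r) * (x : κ) = algebraMap A κ (Φ r) * (y : κ) := by
        rw [← Algebra.smul_def, ← Algebra.smul_def]
        exact congrArg Subtype.val h1
      exact Subtype.ext (mul_left_cancel₀ ((map_ne_zero_iff _ hAκ).2 hΦr) h2)
    calc Module.finrank A B' ≤ Module.finrank A S :=
          LinearMap.finrank_le_finrank_of_injective hmulr
      _ ≤ Fintype.card (Fin N) := finrank_range_le_card _
      _ = Module.finrank R B := by rw [Fintype.card_fin, hN]
  · intro h0
    exact hq.1 (congrArg Subtype.val h0)
  · intro p hp h0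
    let j : FractionRing B' →+* κ :=
      IsFractionRing.lift (A := B') (g := B'.val.toRingHom) Subtype.val_injective
    have hj : ∀ x : B', j (algebraMap B' _ x) = x := fun x => IsFractionRing.lift_algebraMap _ x
    have h1 := congrArg j h0
    have h2 : j.comp ((algebraMap B' (FractionRing B')).comp
        ((algebraMap A B').comp (algebraMap L A))) = algebraMap L κ := RingHom.ext fun l => by
      rw [RingHom.comp_apply, RingHom.comp_apply, hj]
      rfl
    rw [hom_eval₂, map_div₀, hj, hj, hcoe, hcoe, map_zero, h2] at h1
    have h3 : β₀ b / β₀ h = ω / algebraMap R κ ρ₂ := hq.2.trans (by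
      rw [hβρ, ← hβ₀]
      rfl)
    rw [h3] at h1
    exact IsAlgClosed.transcendental_of_notMem_range hωL ⟨p, hp, h1⟩

end

/-! ### Residue degrees of finite morphisms of affine schemes -/

section

open Polynomial TensorProduct

namespace AlgebraicGeometry

theorem Scheme.Hom.residueDegree_isOpenImmersion_comp {X Y Z : Scheme.{u}} (i : X ⟶ Y) (f : Y ⟶ Z)
    [IsOpenImmersion i] (x : X) : (i ≫ f).residueDegree x = f.residueDegree (i x) := by
  have h := Scheme.residueFieldMap_comp i f x
  let e := (asIso (i.residueFieldMap x)).commRingCatIsoToRingEquiv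
  let _ := (f.residueFieldMap (i x)).hom.toAlgebra
  let _ := ((i ≫ f).residueFieldMap x).hom.toAlgebra
  symm
  refine Algebra.finrank_eq_of_equiv_equiv (RingEquiv.refl _) e ?_
  refine RingHom.ext fun y => ?_
  exact congrArg (fun g => g.hom y) h

theorem Scheme.Hom.residueDegree_comp_isOpenImmersion {X Y Z : Scheme.{u}} (f : X ⟶ Y) (i : Y ⟶ Z)
    [IsOpenImmersion i] (x : X) : (f ≫ i).residueDegree x = f.residueDegree x := by
  have h := Scheme.residueFieldMap_comp f i x
  let e := (asIso (i.residueFieldMap (f x))).commRingCatIsoToRingEquiv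
  let _ := (f.residueFieldMap x).hom.toAlgebra
  let _ := ((f ≫ i).residueFieldMap x).hom.toAlgebra
  refine Algebra.finrank_eq_of_equiv_equiv e (RingEquiv.refl _) ?_
  refine RingHom.ext fun y => ?_
  exact (congrArg (fun g => g.hom y) h).symm

/-- Over the generic point of `Spec R`, the residue degree at `x` of a finite morphism
`Spec C ⟶ Spec R` is the rank of the integral closed subscheme of `Spec C` with generic point `x`:
the residue fields are the fraction fields of `R` and of `C ⧸ x`. -/
theorem Scheme.Hom.residueDegree_SpecMap {R C : Type u} [CommRing R] [IsDomain R] [CommRing C]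
    [Algebra R C] [Module.Finite R C] (x : Spec (CommRingCat.of C))
    (hx : (x.asIdeal.comap (algebraMap R C)) = ⊥) :
    (Spec.map (CommRingCat.ofHom (algebraMap R C))).residueDegree x =
      Module.finrank R (C ⧸ x.asIdeal) := by
  set f := Spec.map (CommRingCat.ofHom (algebraMap R C)) with hf
  have hP : x.asIdeal.IsPrime := x.isPrime
  have hQ : (f x).asIdeal.IsPrime := (f x).isPrime
  have hfx : (f x).asIdeal = ⊥ := hx
  let eR := (Scheme.Spec.residueFieldIso (CommRingCat.of R) (f x)).commRingCatIsoToRingEquiv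
  let eC := (Scheme.Spec.residueFieldIso (CommRingCat.of C) x).commRingCatIsoToRingEquiv
  let a : CommRingCat.of R ⟶ (Spec (CommRingCat.of R)).residueField (f x) :=
    CommRingCat.ofHom (algebraMap R (f x).asIdeal.ResidueField) ≫
      (Scheme.Spec.residueFieldIso (CommRingCat.of R) (f x)).inv
  let c : CommRingCat.of C ⟶ (Spec (CommRingCat.of C)).residueField x :=
    CommRingCat.ofHom (algebraMap C x.asIdeal.ResidueField) ≫
      (Scheme.Spec.residueFieldIso (CommRingCat.of C) x).inv
  have hac : a ≫ f.residueFieldMap x = CommRingCat.ofHom (algebraMap R C) ≫ c := by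
    apply Spec.map_injective
    rw [Spec.map_comp, Spec.map_comp, Spec.map_comp, Spec.map_comp,
      Scheme.Spec.map_residueFieldIso_inv_eq_fromSpecResidueField]
    exact (Scheme.Hom.SpecMap_residueFieldMap_fromSpecResidueField f x).trans
      (congrArg (· ≫ f)
        (Scheme.Spec.map_residueFieldIso_inv_eq_fromSpecResidueField (CommRingCat.of C) x).symm)
  have hac' : ∀ r : R, (f.residueFieldMap x).hom (a.hom r) = c.hom (algebraMap R C r) :=
    fun r => congrArg (fun g => g.hom r) hac
  let _ : Algebra (f x).asIdeal.ResidueField x.asIdeal.ResidueField :=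
    ((eC : _ →+* x.asIdeal.ResidueField).comp
      ((f.residueFieldMap x).hom.comp (eR.symm : (f x).asIdeal.ResidueField →+* _))).toAlgebra
  have : IsScalarTower R (f x).asIdeal.ResidueField x.asIdeal.ResidueField := by
    refine IsScalarTower.of_algebraMap_eq fun r => ?_
    have h := congrArg eC (hac' r)
    have h2 : eC (c.hom (algebraMap R C r)) =
        algebraMap C x.asIdeal.ResidueField (algebraMap R C r) :=
      eC.apply_symm_apply _
    rw [IsScalarTower.algebraMap_apply R C x.asIdeal.ResidueField, ← h2, ← h]
    rfl
  have hfr : IsFractionRing R (f x).asIdeal.ResidueField := by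
    have h (I : Ideal R) (hI : I.IsPrime) (h0 : I = ⊥) : IsFractionRing R I.ResidueField := by
      subst h0
      infer_instance
    exact h _ hQ hfx
  have hi : Function.Injective (algebraMap R (C ⧸ x.asIdeal)) := by
    rw [injective_iff_map_eq_zero]
    intro r hr
    have : r ∈ x.asIdeal.comap (algebraMap R C) :=
      Ideal.mem_comap.mpr (Ideal.Quotient.eq_zero_iff_mem.mp hr)
    rwa [hx] at this
  have : FaithfulSMul R (C ⧸ x.asIdeal) := (faithfulSMul_iff_algebraMap_injective _ _).mpr hi
  have : IsScalarTower R (C ⧸ x.asIdeal) x.asIdeal.ResidueField := inferInstance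
  rw [← IsFractionRing.finrank_eq R (f x).asIdeal.ResidueField (C ⧸ x.asIdeal)
    x.asIdeal.ResidueField]
  let _ := (f.residueFieldMap x).hom.toAlgebra
  refine Algebra.finrank_eq_of_equiv_equiv eR eC ?_
  refine RingHom.ext fun y => ?_
  change eC ((f.residueFieldMap x).hom (eR.symm (eR y))) = eC ((f.residueFieldMap x).hom y)
  rw [eR.symm_apply_apply]

end AlgebraicGeometry

end

/-! ### Affine varieties, curves and covers -/

section

open Polynomial TensorProduct

theorem Algebra.IsIntegral.ringKrullDim_eq (R S : Type*) [CommRing R] [CommRing S] [Algebra R S]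
    [Algebra.IsIntegral R S] [FaithfulSMul R S] : ringKrullDim S = ringKrullDim R := by
  refine le_antisymm (Order.krullDim_le_of_strictMono (PrimeSpectrum.comap (algebraMap R S))
    fun P Q h => Ideal.IsIntegral.comap_lt_comap h) ?_
  refine iSup_le fun l => ?_
  obtain ⟨⟨Q, hQ, hl⟩⟩ := Ideal.nonempty_primesOver (S := S) l.head.asIdeal
  obtain ⟨l', h, -⟩ := Ideal.exists_ltSeries_of_hasGoingUp l Q
  rw [← h]
  exact Order.LTSeries.length_le_krullDim l'

/-- Noether normalization in dimension one. -/
theorem exists_finite_injective_polynomial_of_ringKrullDim_eq_one (K S : Type*) [Field K]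
    [CommRing S] [Algebra K S] [Algebra.FiniteType K S] (h : ringKrullDim S = 1) :
    ∃ φ : K[X] →ₐ[K] S, Function.Injective φ ∧ φ.Finite := by
  have : Nontrivial S := by
    by_contra hn
    rw [not_nontrivial_iff_subsingleton] at hn
    rw [ringKrullDim_eq_bot_of_subsingleton] at h
    exact absurd h (by decide)
  obtain ⟨s, g, hg, hfin⟩ := exists_finite_inj_algHom_of_fg K S
  let _ : Algebra (MvPolynomial (Fin s) K) S := g.toRingHom.toAlgebra
  have : Module.Finite (MvPolynomial (Fin s) K) S := hfin
  have : FaithfulSMul (MvPolynomial (Fin s) K) S :=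
    (faithfulSMul_iff_algebraMap_injective _ _).mpr hg
  rw [Algebra.IsIntegral.ringKrullDim_eq (MvPolynomial (Fin s) K) S] at h
  simp only [MvPolynomial.ringKrullDim_of_isNoetherianRing, ringKrullDim_eq_zero_of_field,
    Nat.card_eq_fintype_card, Fintype.card_fin, zero_add] at h
  obtain rfl : s = 1 := by exact_mod_cast h
  let e := (MvPolynomial.uniqueAlgEquiv K (Fin 1)).symm
  exact ⟨g.comp e.toAlgHom, hg.comp e.injective,
    RingHom.Finite.comp hfin (RingHom.Finite.of_surjective _ e.surjective)⟩

theorem exists_isIntegral_injective_polynomial_tensorProduct {K L S : Type*} [Field K] [Field L]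
    [Algebra K L] [CommRing S] [Algebra K S] (ι : K[X] →ₐ[K] S) (hι : Function.Injective ι)
    (hint : ι.toRingHom.IsIntegral) :
    ∃ ψ : L[X] →ₐ[L] L ⊗[K] S, Function.Injective ψ ∧ ψ.toRingHom.IsIntegral := by
  let ψ : L[X] →ₐ[L] L ⊗[K] S := aeval (1 ⊗ₜ ι X)
  have hψ : ∀ p : K[X], ψ (p.map (algebraMap K L)) = 1 ⊗ₜ ι p := by
    intro p
    have : (ψ.restrictScalars K).comp (mapAlgHom (Algebra.ofId K L)) =
        Algebra.TensorProduct.includeRight.comp ι := by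
      refine Polynomial.algHom_ext ?_
      simp [ψ]
    exact DFunLike.congr_fun this p
  refine ⟨ψ, ?_, ?_⟩
  · have h1 : Function.Injective (TensorProduct.map LinearMap.id ι.toLinearMap :
        L ⊗[K] K[X] →ₗ[K] L ⊗[K] S) :=
      Module.Flat.lTensor_preserves_injective_linearMap ι.toLinearMap hι
    have h2 : ∀ t, ψ ((polyEquivTensor K L).symm t) =
        TensorProduct.map LinearMap.id ι.toLinearMap t := by
      intro t
      induction t with
      | zero => simp
      | add x y hx hy => rw [map_add, map_add, map_add, hx, hy]
      | tmul a p =>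
        rw [polyEquivTensor_symm_apply_tmul_eq_smul, map_smul, hψ, TensorProduct.smul_tmul',
          smul_eq_mul, mul_one]
        rfl
    have h3 : Function.Injective (ψ ∘ (polyEquivTensor K L).symm) := by
      rwa [show ψ ∘ (polyEquivTensor K L).symm = _ from funext h2]
    exact (Function.Injective.of_comp_iff' ψ (polyEquivTensor K L).symm.bijective).mp h3
  · intro x
    induction x with
    | zero => exact ψ.toRingHom.isIntegralElem_zero
    | add x y hx hy => exact hx.add _ hy
    | tmul l s =>
      have h1 : l ⊗ₜ s = ψ (C l) * (1 ⊗ₜ s) := by simp [ψ, Algebra.TensorProduct.algebraMap_apply]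
      rw [h1]
      refine RingHom.IsIntegralElem.mul _ (ψ.toRingHom.isIntegralElem_map) ?_
      obtain ⟨p, hp, hs⟩ := hint s
      refine ⟨p.map (mapRingHom (algebraMap K L)), hp.map _, ?_⟩
      rw [eval₂_map]
      have h3 : ψ.toRingHom.comp (mapRingHom (algebraMap K L)) =
          (Algebra.TensorProduct.includeRight : S →ₐ[K] L ⊗[K] S).toRingHom.comp ι.toRingHom :=
        RingHom.ext hψ
      rw [h3]
      have := congrArg (Algebra.TensorProduct.includeRight : S →ₐ[K] L ⊗[K] S).toRingHom hs
      rw [hom_eval₂, map_zero] at this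
      exact this

namespace AlgebraicGeometry

instance : ObjectProperty.IsClosedUnderIsomorphisms (C := Scheme.{u}) IsIntegral where
  of_iso e _ := IsIntegral.of_isIso e.hom

end AlgebraicGeometry

namespace ConstantCovers

/-- Geometric integrality of an affine scheme, as a condition on tensor products. -/
theorem isVariety_Spec {k A : Type u} [Field k] [CommRing A] [Algebra k A]
    [Algebra.FiniteType k A]
    (h : ∀ (Ω : Type u) [Field Ω] [Algebra k Ω], IsDomain (Ω ⊗[k] A)) :
    IsVariety (Spec.map (CommRingCat.ofHom (algebraMap k A))) where
  geometricallyIntegral := by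
    rw [geometricallyIntegral_iff, geometrically_iff_of_commRing_of_isClosedUnderIsomorphisms]
    intro Ω _ _
    have := h Ω
    have : IsDomain (CommRingCat.of (A ⊗[k] Ω)) :=
      (Algebra.TensorProduct.comm k Ω A).toRingEquiv.symm.toMulEquiv.isDomain _
    exact IsIntegral.of_isIso (pullbackSpecIso k A Ω).inv
  isSeparated := inferInstance
  locallyOfFiniteType := by
    rw [HasRingHomProperty.Spec_iff (P := @LocallyOfFiniteType)]
    exact (RingHom.finiteType_algebraMap (A := k) (B := A)).mpr inferInstance
  quasiCompact := inferInstance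

theorem IsVariety.baseChangeHom {k : Type u} [Field k] {X : Scheme.{u}}
    {p : X ⟶ Spec (CommRingCat.of k)} (h : IsVariety p) (L : Type u) [Field L] [Algebra k L] :
    IsVariety (baseChangeHom p L) := by
  have := h.geometricallyIntegral
  have := h.isSeparated
  have := h.locallyOfFiniteType
  have := h.quasiCompact
  constructor <;> infer_instance

/-- A finite extension of domains is a cover whose degree is its rank. The isomorphism `e` allows
for a base that is only isomorphic to an affine scheme. -/
theorem isCover_Spec {R B : Type u} [CommRing R] [IsDomain R] [CommRing B] [IsDomain B]
    [Algebra R B] [Module.Finite R B] [FaithfulSMul R B] {Y : Scheme.{u}}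
    (e : Spec (CommRingCat.of R) ⟶ Y) [IsIso e] :
    IsCover (Spec.map (CommRingCat.ofHom (algebraMap R B)) ≫ e) (Module.finrank R B) where
  isIntegral := IsIntegral.of_isIso e
  isFinite := by
    have : IsFinite (Spec.map (CommRingCat.ofHom (algebraMap R B))) := by
      rw [IsFinite.SpecMap_iff]
      exact RingHom.finite_algebraMap.mpr inferInstance
    infer_instance
  isReduced := inferInstance
  finite_irreducibleComponents := by
    rw [irreducibleComponents_eq_singleton]
    exact Set.finite_singleton _
  image_component W hW := by
    rw [irreducibleComponents_eq_singleton] at hW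
    obtain rfl := hW
    rw [Set.image_univ, Set.range_eq_univ]
    intro y
    obtain ⟨x, rfl⟩ := (Scheme.homeoOfIso (asIso e)).surjective y
    have : x.asIdeal.IsPrime := x.isPrime
    obtain ⟨⟨Q, hQ, hl⟩⟩ := Ideal.nonempty_primesOver (S := B) x.asIdeal
    refine ⟨(⟨Q, hQ⟩ : PrimeSpectrum B), ?_⟩
    refine (Scheme.Hom.comp_apply _ e _).trans (congrArg e ?_)
    exact PrimeSpectrum.ext hl.over.symm
  sum_degree := by
    rw [genericPoints_eq_singleton, finsum_mem_singleton,
      Scheme.Hom.residueDegree_comp_isOpenImmersion]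
    have h0 : (genericPoint (Spec (CommRingCat.of B))).asIdeal = ⊥ :=
      congrArg PrimeSpectrum.asIdeal (genericPoint_eq_bot_of_affine (CommRingCat.of B))
    rw [Scheme.Hom.residueDegree_SpecMap, h0]
    · exact ((AlgEquiv.quotientBot R B).toLinearEquiv).finrank_eq
    · rw [h0, ← RingHom.ker_eq_comap_bot]
      exact (RingHom.injective_iff_ker_eq_bot _).mp (FaithfulSMul.algebraMap_injective R B)

/-- A geometrically integral algebra that is finite over `k[X]` and contains it defines a constant
curve. -/
theorem isCurve_baseChangeHom_Spec {k L A : Type u} [Field k] [Field L] [Algebra k L]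
    [CommRing A] [Algebra k A] (h : ∀ (Ω : Type u) [Field Ω] [Algebra k Ω], IsDomain (Ω ⊗[k] A))
    (ι : k[X] →ₐ[k] A) (hι : Function.Injective ι) (hfin : ι.Finite) :
    IsVariety (Spec.map (CommRingCat.ofHom (algebraMap k A))) ∧
    IsCurve (baseChangeHom (Spec.map (CommRingCat.ofHom (algebraMap k A))) L) := by
  have : Algebra.FiniteType k A := by
    have h1 := RingHom.FiniteType.comp hfin.to_finiteType
      (RingHom.finiteType_algebraMap.mpr (inferInstance : Algebra.FiniteType k k[X]))
    refine RingHom.finiteType_algebraMap.mp ?_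
    rwa [AlgHom.toRingHom_eq_coe, AlgHom.comp_algebraMap] at h1
  have hv := isVariety_Spec h
  refine ⟨hv, { toIsVariety := hv.baseChangeHom L, dim_eq_one := ?_ }⟩
  rw [(Scheme.homeoOfIso (pullbackSpecIso k A L)).isHomeomorph.topologicalKrullDim_eq]
  refine (PrimeSpectrum.topologicalKrullDim_eq_ringKrullDim (R := A ⊗[k] L)).trans ?_
  rw [ringKrullDim_eq_of_ringEquiv (Algebra.TensorProduct.comm k A L).toRingEquiv]
  obtain ⟨ψ, hψ, hint⟩ := exists_isIntegral_injective_polynomial_tensorProduct (L := L) ι hι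
    hfin.to_isIntegral
  let _ : Algebra L[X] (L ⊗[k] A) := ψ.toRingHom.toAlgebra
  have : Algebra.IsIntegral L[X] (L ⊗[k] A) := ⟨hint⟩
  have : FaithfulSMul L[X] (L ⊗[k] A) := (faithfulSMul_iff_algebraMap_injective _ _).mpr hψ
  rw [Algebra.IsIntegral.ringKrullDim_eq L[X] (L ⊗[k] A)]
  simp

end ConstantCovers

end

/-! ### Affine charts of varieties -/

section

open Polynomial TensorProduct

namespace ConstantCovers

/-- An affine chart `Spec A` of `X` gives the affine chart `Spec (L ⊗ A)` of `X_L`. -/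
theorem exists_isOpenImmersion_baseChange {K A : Type u} [Field K] [CommRing A] [Algebra K A]
    {X : Scheme.{u}} {p : X ⟶ Spec (CommRingCat.of K)} (j : Spec (CommRingCat.of A) ⟶ X)
    [IsOpenImmersion j] (hj : j ≫ p = Spec.map (CommRingCat.ofHom (algebraMap K A)))
    (L : Type u) [Field L] [Algebra K L] :
    ∃ t : Spec (CommRingCat.of (L ⊗[K] A)) ⟶ baseChange p L, IsOpenImmersion t ∧
      t ≫ baseChangeHom p L = Spec.map (CommRingCat.ofHom (algebraMap L (L ⊗[K] A))) := by
  let e := (pullbackSpecIso K L A).symm ≪≫ pullbackSymmetry _ _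
  let m : pullback (Spec.map (CommRingCat.ofHom (algebraMap K A))) (specMap K L) ⟶
      baseChange p L :=
    pullback.map _ _ _ _ j (𝟙 _) (𝟙 _) (by rw [Category.comp_id, hj]) (by simp)
  refine ⟨e.hom ≫ m, ?_, ?_⟩
  · infer_instance
  · have h1 : m ≫ baseChangeHom p L = pullback.snd _ _ := by
      simp only [m, pullback.map, pullback.lift_snd, Category.comp_id]
    rw [Category.assoc, h1]
    simp only [e, Iso.trans_hom, Iso.symm_hom, Category.assoc, pullbackSymmetry_hom_comp_snd]
    exact pullbackSpecIso_inv_fst' K L A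

theorem IsVariety.exists_affine {K : Type u} [Field K] {X : Scheme.{u}}
    {p : X ⟶ Spec (CommRingCat.of K)} (h : IsVariety p) (x : X) :
    ∃ (A : Type u) (_ : CommRing A) (_ : Algebra K A) (j : Spec (CommRingCat.of A) ⟶ X),
      IsOpenImmersion j ∧ x ∈ Set.range j ∧
      j ≫ p = Spec.map (CommRingCat.ofHom (algebraMap K A)) ∧ Algebra.FiniteType K A ∧
      ∀ (Ω : Type u) [Field Ω] [Algebra K Ω], IsDomain (Ω ⊗[K] A) := by
  obtain ⟨A, j, hj, hx⟩ : ∃ (A : CommRingCat.{u}) (j : Spec A ⟶ X), IsOpenImmersion j ∧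
    x ∈ Set.range j :=
    ⟨_, X.affineCover.f (X.affineCover.idx x), X.affineCover.map_prop _, X.affineCover.covers x⟩
  obtain ⟨φ, hφ⟩ := Spec.map_surjective (j ≫ p)
  let _ : Algebra K A := φ.hom.toAlgebra
  have hφ' : j ≫ p = Spec.map (CommRingCat.ofHom (algebraMap K A)) := hφ.symm
  refine ⟨A, inferInstance, inferInstance, j, hj, hx, hφ', ?_, ?_⟩
  · have := h.locallyOfFiniteType
    have h2 : LocallyOfFiniteType (j ≫ p) := inferInstance
    rw [hφ', HasRingHomProperty.Spec_iff (P := @LocallyOfFiniteType)] at h2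
    exact RingHom.finiteType_algebraMap.mp h2
  · intro Ω _ _
    obtain ⟨t, ht, -⟩ := exists_isOpenImmersion_baseChange (A := A) j hφ' Ω
    have := h.geometricallyIntegral
    have : Nonempty (Spec A) := ⟨hx.choose⟩
    have : Nontrivial A := PrimeSpectrum.nonempty_iff_nontrivial.mp this
    have : Nonempty (Spec (CommRingCat.of (Ω ⊗[K] A))) :=
      PrimeSpectrum.nonempty_iff_nontrivial.mpr inferInstance
    have : IsIntegral (Spec (CommRingCat.of (Ω ⊗[K] A))) := isIntegral_of_isOpenImmersion t
    exact (affine_isIntegral_iff _).mp this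

/-- A curve has an affine chart with a finite map onto the affine line. The chart is chosen around
a point that is a proper specialization, so that it has dimension exactly one. -/
theorem IsCurve.exists_affine {K : Type u} [Field K] {X : Scheme.{u}}
    {p : X ⟶ Spec (CommRingCat.of K)} (h : IsCurve p) :
    ∃ (A : Type u) (_ : CommRing A) (_ : Algebra K A) (j : Spec (CommRingCat.of A) ⟶ X)
      (ι : K[X] →ₐ[K] A), Function.Injective ι ∧ ι.Finite ∧
      IsOpenImmersion j ∧
      j ≫ p = Spec.map (CommRingCat.ofHom (algebraMap K A)) ∧
      ∀ (Ω : Type u) [Field Ω] [Algebra K Ω], IsDomain (Ω ⊗[K] A) := by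
  have hd := h.dim_eq_one
  obtain ⟨Z, W, hZW⟩ := Order.one_le_krullDim_iff.mp hd.ge
  obtain ⟨z, hz⟩ := QuasiSober.sober Z.isIrreducible Z.isClosed
  obtain ⟨w, hw⟩ := QuasiSober.sober W.isIrreducible W.isClosed
  have hwz : w ⤳ z := hw.specializes (hZW.le hz.mem)
  have hne : z ≠ w := by
    rintro rfl
    exact hZW.ne (TopologicalSpace.IrreducibleCloseds.ext (hz.symm.trans hw))
  obtain ⟨A, _, _, j, hj, ⟨z, rfl⟩, hjp, hA, hΩ⟩ := h.toIsVariety.exists_affine z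
  obtain ⟨w, rfl⟩ := hwz.mem_open j.isOpenEmbedding.isOpen_range ⟨z, rfl⟩
  rw [j.isOpenEmbedding.isInducing.specializes_iff] at hwz
  have hd1 : ringKrullDim A = 1 := by
    refine le_antisymm ?_ ?_
    · rw [← hd]
      refine (PrimeSpectrum.topologicalKrullDim_eq_ringKrullDim (R := A)).symm.trans_le ?_
      exact j.isOpenEmbedding.isInducing.topologicalKrullDim_le
    · refine Order.one_le_krullDim_iff.mpr ⟨w, z, lt_of_le_of_ne ?_ ?_⟩
      · exact (PrimeSpectrum.le_iff_specializes _ _).mpr hwz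
      · rintro rfl
        exact hne rfl
  obtain ⟨ι, hι, hfin⟩ := exists_finite_injective_polynomial_of_ringKrullDim_eq_one K A hd1
  exact ⟨A, _, _, j, ι, hι, hfin, hj, hjp, hΩ⟩

end ConstantCovers

end

/-! ### The affine form of a dominating cover -/

section

open Polynomial TensorProduct

namespace AlgebraicGeometry

/-- The preimage of an affine chart under a finite morphism, as an affine chart. -/
theorem exists_Spec_of_isFinite {R : Type u} [CommRing R] {Y Z : Scheme.{u}} (f : Z ⟶ Y)
    [IsFinite f] (j : Spec (CommRingCat.of R) ⟶ Y) [IsOpenImmersion j] :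
    ∃ (C : Type u) (_ : CommRing C) (_ : Algebra R C) (i : Spec (CommRingCat.of C) ⟶ Z),
      Module.Finite R C ∧ IsOpenImmersion i ∧
      i ≫ f = Spec.map (CommRingCat.ofHom (algebraMap R C)) ≫ j ∧
      Set.range i = f ⁻¹' Set.range j := by
  have : IsAffine (pullback f j) := isAffine_of_isAffineHom (pullback.snd f j)
  let e := (pullback f j).isoSpec
  obtain ⟨φ, hφ⟩ := Spec.map_surjective (e.inv ≫ pullback.snd f j)
  let C := Γ(pullback f j, ⊤)
  let _ : Algebra R C := φ.hom.toAlgebra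
  refine ⟨C, inferInstance, inferInstance, e.inv ≫ pullback.fst f j, ?_, inferInstance, ?_, ?_⟩
  · have : IsFinite (Spec.map φ) := by rw [hφ]; infer_instance
    rw [IsFinite.SpecMap_iff] at this
    exact this
  · rw [Category.assoc, pullback.condition, ← Category.assoc, ← hφ]
    rfl
  · rw [Scheme.Hom.comp_base, TopCat.coe_comp, Set.range_comp]
    have h : Set.range e.inv = Set.univ :=
      Set.range_eq_univ.mpr (Scheme.homeoOfIso e.symm).surjective
    rw [h, Set.image_univ, Scheme.Pullback.range_fst]

/-- If `Z` has finitely many irreducible components, one of them dominates an irreducible scheme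
dominated by `Z`. -/
theorem exists_genericPoints_of_isDominant {Z T : Scheme.{u}} (g : Z ⟶ T) [IsDominant g]
    [IrreducibleSpace T] (hZ : (irreducibleComponents Z).Finite) :
    ∃ z ∈ genericPoints Z, g z = genericPoint T := by
  have hfin := genericPoints.finite hZ
  have hc : IsClosed (⋃ z ∈ genericPoints Z, closure {g z}) :=
    hfin.isClosed_biUnion fun _ _ => isClosed_closure
  have hr : Set.range g ⊆ ⋃ z ∈ genericPoints Z, closure {g z} := by
    rintro _ ⟨x, rfl⟩
    let z := genericPoints.ofComponent
      ⟨irreducibleComponent x, irreducibleComponent_mem_irreducibleComponents x⟩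
    refine Set.mem_biUnion z.2 (specializes_iff_mem_closure.mp ?_)
    refine Specializes.map ?_ g.continuous
    rw [specializes_iff_mem_closure]
    have := genericPoints.isGenericPoint_ofComponent
      ⟨irreducibleComponent x, irreducibleComponent_mem_irreducibleComponents x⟩
    rw [this.def]
    exact mem_irreducibleComponent
  have hη : genericPoint T ∈ ⋃ z ∈ genericPoints Z, closure {g z} := by
    refine closure_minimal hr hc ?_
    rw [g.denseRange.closure_range]
    trivial
  obtain ⟨z, hz, h⟩ := Set.mem_iUnion₂.mp hη
  exact ⟨z, hz, (specializes_iff_mem_closure.mpr h).antisymm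
    (genericPoint_specializes _) |>.eq⟩

end AlgebraicGeometry

namespace ConstantCovers

theorem IsCover.apply_eq_genericPoint {Z Y : Scheme.{u}} {f : Z ⟶ Y} {d : ℕ} (hf : IsCover f d)
    [IrreducibleSpace Y] {z : Z} (hz : z ∈ genericPoints Z) : f z = genericPoint Y := by
  have h := hf.image_component _ hz
  obtain ⟨x, hx, hxY⟩ := h.ge (Set.mem_univ (genericPoint Y))
  refine (?_ : f z ⤳ genericPoint Y).antisymm (genericPoint_specializes _) |>.eq
  rw [← hxY]
  exact Specializes.map (specializes_iff_mem_closure.mpr hx) f.continuous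

theorem IsCover.residueDegree_le {Z Y : Scheme.{u}} {f : Z ⟶ Y} {d : ℕ} (hf : IsCover f d)
    {z : Z} (hz : z ∈ genericPoints Z) : f.residueDegree z ≤ d := by
  have hfin := genericPoints.finite hf.finite_irreducibleComponents
  have h := hf.sum_degree
  rw [finsum_mem_eq_finite_toFinset_sum _ hfin] at h
  rw [← h]
  exact Finset.single_le_sum (fun _ _ => Nat.zero_le _) (hfin.mem_toFinset.mpr hz)

/-- Let a cover of `Y` of degree `d` dominate `T`. Over an affine chart `Spec R` of `Y`, a
component of the cover that dominates `T` is the spectrum of a finite extension of `R` of rank at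
most `d`. -/
theorem IsCover.exists_affine_component {R : Type u} [CommRing R] [IsDomain R]
    {Z Y T : Scheme.{u}} {f : Z ⟶ Y} {d : ℕ} (hf : IsCover f d)
    (g : Z ⟶ T) [IsDominant g] [IrreducibleSpace T]
    (j : Spec (CommRingCat.of R) ⟶ Y) [IsOpenImmersion j] :
    ∃ (B : Type u) (_ : CommRing B) (_ : IsDomain B) (_ : Algebra R B)
      (v : Spec (CommRingCat.of B) ⟶ Z), Module.Finite R B ∧ FaithfulSMul R B ∧
      v ≫ f = Spec.map (CommRingCat.ofHom (algebraMap R B)) ≫ j ∧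
      Module.finrank R B ≤ d ∧
      (v ≫ g) (genericPoint (Spec (CommRingCat.of B))) = genericPoint T := by
  have := hf.isFinite
  have := hf.isIntegral
  obtain ⟨z, hz, hgz⟩ := exists_genericPoints_of_isDominant g hf.finite_irreducibleComponents
  have hfz := hf.apply_eq_genericPoint hz
  obtain ⟨C, _, _, i, hC, hi, hij, hrange⟩ := exists_Spec_of_isFinite f j
  have hj := genericPoint_eq_of_isOpenImmersion j
  obtain ⟨x, rfl⟩ : z ∈ Set.range i := by
    rw [hrange, Set.mem_preimage, hfz]
    exact ⟨_, hj⟩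
  have hx : x.asIdeal.comap (algebraMap R C) = ⊥ := by
    have h1 : Spec.map (CommRingCat.ofHom (algebraMap R C)) x =
        genericPoint (Spec (CommRingCat.of R)) := by
      apply j.isOpenEmbedding.injective
      rw [hj, ← hfz, ← Scheme.Hom.comp_apply, ← Scheme.Hom.comp_apply, hij]
    exact (congrArg PrimeSpectrum.asIdeal h1).trans
      (congrArg PrimeSpectrum.asIdeal (genericPoint_eq_bot_of_affine (CommRingCat.of R)))
  have hprime : x.asIdeal.IsPrime := x.isPrime
  refine ⟨C ⧸ x.asIdeal, inferInstance, inferInstance, inferInstance,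
    Spec.map (CommRingCat.ofHom (Ideal.Quotient.mk x.asIdeal)) ≫ i, inferInstance, ?_, ?_, ?_, ?_⟩
  · rw [faithfulSMul_iff_algebraMap_injective, injective_iff_map_eq_zero]
    intro r hr
    have : r ∈ x.asIdeal.comap (algebraMap R C) :=
      Ideal.mem_comap.mpr (Ideal.Quotient.eq_zero_iff_mem.mp hr)
    rwa [hx] at this
  · rw [Category.assoc, hij, ← Category.assoc, ← Spec.map_comp]
    rfl
  · refine le_of_eq_of_le ?_ (hf.residueDegree_le hz)
    rw [← Scheme.Hom.residueDegree_isOpenImmersion_comp, hij,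
      Scheme.Hom.residueDegree_comp_isOpenImmersion, Scheme.Hom.residueDegree_SpecMap x hx]
  · rw [← hgz, Category.assoc, Scheme.Hom.comp_apply, Scheme.Hom.comp_apply]
    congr 2
    have h0 := genericPoint_eq_bot_of_affine (CommRingCat.of (C ⧸ x.asIdeal))
    rw [h0]
    refine PrimeSpectrum.ext ?_
    exact Ideal.mk_ker

theorem isDominant_of_mem_range {X T : Scheme.{u}} [IrreducibleSpace T] (f : X ⟶ T)
    (h : genericPoint T ∈ Set.range f) : IsDominant f := by
  refine ⟨dense_iff_closure_eq.mpr (Set.eq_univ_of_univ_subset ?_)⟩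
  rw [← (genericPoint_spec T).def]
  exact closure_mono (Set.singleton_subset_iff.mpr h)

/-- Let `T` have an affine chart `Spec S`, where `S` is integral over a polynomial ring `L[X]`. A
dominant morphism `γ : Spec B ⟶ T` pulls `X` back to a fraction `b / h` that is transcendental over
`L`. Conversely, composing `γ` with a morphism `Spec B' ⟶ Spec B` gives a dominant morphism as soon
as the image of `b / h` in the fraction field of `B'` is defined and transcendental over `L`. -/
theorem exists_transcendental_of_dominates_curve {L S B : Type u} [Field L]
    [CommRing S] [IsDomain S]
    [Algebra L S] [CommRing B] [IsDomain B] [Algebra L B] {T : Scheme.{u}} [IrreducibleSpace T]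
    {q : T ⟶ Spec (CommRingCat.of L)} (t : Spec (CommRingCat.of S) ⟶ T) [IsOpenImmersion t]
    (ht : t ≫ q = Spec.map (CommRingCat.ofHom (algebraMap L S)))
    (ψ : L[X] →ₐ[L] S) (hψ : Function.Injective ψ) (hint : ψ.toRingHom.IsIntegral)
    (γ : Spec (CommRingCat.of B) ⟶ T)
    (hγ : γ ≫ q = Spec.map (CommRingCat.ofHom (algebraMap L B)))
    (hgen : γ (genericPoint (Spec (CommRingCat.of B))) = genericPoint T) :
    ∃ b h : B, h ≠ 0 ∧ Transcendental L
        (algebraMap B (FractionRing B) b / algebraMap B (FractionRing B) h) ∧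
      ∀ (B' : Type u) [CommRing B'] [IsDomain B'] (β : B →+* B'), β h ≠ 0 →
        (∀ p : L[X], p ≠ 0 →
          p.eval₂ ((algebraMap B' (FractionRing B')).comp (β.comp (algebraMap L B)))
          (algebraMap B' (FractionRing B') (β b) / algebraMap B' (FractionRing B') (β h)) ≠ 0) →
        IsDominant (Spec.map (CommRingCat.ofHom β) ≫ γ) := by
  have hbot := genericPoint_eq_bot_of_affine (CommRingCat.of B)
  have ht0 : t (genericPoint (Spec (CommRingCat.of S))) = genericPoint T :=
    genericPoint_eq_of_isOpenImmersion t
  have hbotS := genericPoint_eq_bot_of_affine (CommRingCat.of S)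
  -- a basic open set mapped into the chart
  obtain ⟨h, hh, hD⟩ : ∃ h : B, h ≠ 0 ∧
      Set.range (Spec.map (CommRingCat.ofHom (algebraMap B (Localization.Away h))) ≫ γ) ⊆
        Set.range t := by
    obtain ⟨_, ⟨h, rfl⟩, hm, hsub⟩ :=
      PrimeSpectrum.isTopologicalBasis_basic_opens.exists_subset_of_mem_open
      (u := (γ ⁻¹' Set.range t : Set (Spec (CommRingCat.of B))))
      (a := genericPoint (Spec (CommRingCat.of B))) ⟨_, ht0.trans hgen.symm⟩
      (t.isOpenEmbedding.isOpen_range.preimage γ.continuous)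
    refine ⟨h, fun h0 => hm ?_, ?_⟩
    · rw [h0]
      exact Submodule.zero_mem _
    · rintro _ ⟨x, rfl⟩
      refine hsub ?_
      exact (PrimeSpectrum.localization_away_comap_range (Localization.Away h) h).le ⟨x, rfl⟩
  obtain ⟨σ, hσ⟩ := Spec.map_surjective (IsOpenImmersion.lift t _ hD)
  have hσt : Spec.map σ ≫ t =
      Spec.map (CommRingCat.ofHom (algebraMap B (Localization.Away h))) ≫ γ := by
    rw [hσ, IsOpenImmersion.lift_fac]
  have hσL : σ.hom.comp (algebraMap L S) =
      (algebraMap B (Localization.Away h)).comp (algebraMap L B) := by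
    have h1 := congrArg (· ≫ q) hσt
    simp only [Category.assoc, ht, hγ, ← Spec.map_comp] at h1
    exact congrArg CommRingCat.Hom.hom (Spec.map_injective h1)
  obtain ⟨⟨b, ⟨_, n, rfl⟩⟩, hb⟩ := IsLocalization.surj (Submonoid.powers h) (σ.hom (ψ X))
  -- the induced homomorphism from the coordinate ring of the curve, in terms of the coordinate
  have key (B' : Type u) [CommRing B'] [IsDomain B'] (β : B →+* B') (hβ : β h ≠ 0) :
      ∃ ρ : S →+* FractionRing B',
        Spec.map (CommRingCat.ofHom ρ) ≫ t =
          Spec.map (CommRingCat.ofHom (algebraMap B' (FractionRing B'))) ≫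
            Spec.map (CommRingCat.ofHom β) ≫ γ ∧
        ∀ p : L[X], ρ (ψ p) =
          p.eval₂ ((algebraMap B' (FractionRing B')).comp (β.comp (algebraMap L B)))
            (algebraMap B' (FractionRing B') (β (b * h)) /
              algebraMap B' (FractionRing B') (β (h ^ (n + 1)))) := by
    have hβ' : algebraMap B' (FractionRing B') (β h) ≠ 0 := by
      rwa [Ne, FaithfulSMul.algebraMap_eq_zero_iff]
    let τ : Localization.Away h →+* FractionRing B' :=
      IsLocalization.Away.lift h (g := (algebraMap B' (FractionRing B')).comp β)
        (isUnit_iff_ne_zero.mpr hβ')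
    have hτ : τ.comp (algebraMap B (Localization.Away h)) =
        (algebraMap B' (FractionRing B')).comp β := IsLocalization.Away.lift_comp h _
    refine ⟨τ.comp σ.hom, ?_, fun p => ?_⟩
    · have h1 : CommRingCat.ofHom (τ.comp σ.hom) = σ ≫ CommRingCat.ofHom τ := rfl
      rw [h1, Spec.map_comp, Category.assoc, hσt, ← Category.assoc, ← Category.assoc,
        ← Spec.map_comp, ← Spec.map_comp, ← CommRingCat.ofHom_comp, ← CommRingCat.ofHom_comp, hτ]
    · have h1 := Polynomial.hom_eval₂ p (algebraMap L S) (τ.comp σ.hom) (ψ X)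
      rw [← aeval_def, aeval_algHom_apply, aeval_X_left_apply] at h1
      rw [h1, RingHom.comp_assoc, hσL, ← RingHom.comp_assoc, hτ, RingHom.comp_assoc]
      congr 1
      rw [eq_div_iff (by rw [map_pow, map_pow]; exact pow_ne_zero _ hβ')]
      have h2 := congrArg τ hb
      rw [map_mul] at h2
      have h3 := fun x => DFunLike.congr_fun hτ x
      simp only [RingHom.comp_apply] at h3 ⊢
      rw [h3, h3] at h2
      rw [pow_succ, map_mul, map_mul, map_mul, map_mul, ← mul_assoc]
      exact congrArg (· * _) h2
  -- the extra factor `h` ensures that `h` is invertible where the denominator is, even if `n = 0`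
  refine ⟨b * h, h ^ (n + 1), pow_ne_zero _ hh, ?_, fun B' _ _ β hβ hp => ?_⟩
  · obtain ⟨ρ, hρ, hρp⟩ := key B (RingHom.id B) hh
    have hinj : Function.Injective ρ := by
      have h1 : (Spec.map (CommRingCat.ofHom ρ) ≫ t)
          (genericPoint (Spec (CommRingCat.of (FractionRing B)))) =
          t (genericPoint (Spec (CommRingCat.of S))) := by
        rw [hρ, ht0, ← hgen, CommRingCat.ofHom_id, Spec.map_id, Category.id_comp,
          Scheme.Hom.comp_apply]
        congr 1
        rw [hbot, genericPoint_eq_bot_of_affine (CommRingCat.of (FractionRing B))]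
        refine PrimeSpectrum.ext ?_
        exact (RingHom.injective_iff_ker_eq_bot _).mp (IsFractionRing.injective B _)
      rw [Scheme.Hom.comp_apply] at h1
      have h2 := t.isOpenEmbedding.injective h1
      rw [hbotS, genericPoint_eq_bot_of_affine (CommRingCat.of (FractionRing B))] at h2
      exact (RingHom.injective_iff_ker_eq_bot _).mpr (congrArg PrimeSpectrum.asIdeal h2)
    rw [transcendental_iff]
    intro p hp
    refine hψ (hinj ?_)
    rw [map_zero, map_zero, hρp]
    exact hp
  · have hβ' : β h ≠ 0 := fun h0 => hβ (by rw [map_pow, h0, zero_pow n.succ_ne_zero])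
    obtain ⟨ρ, hρ, hρp⟩ := key B' β hβ'
    -- the kernel meets `L[X]` trivially, and `S` is integral over `L[X]`
    have hinj : RingHom.ker ρ = ⊥ := by
      let _ : Algebra L[X] S := ψ.toRingHom.toAlgebra
      have : Algebra.IsIntegral L[X] S := ⟨hint⟩
      refine Ideal.eq_bot_of_comap_eq_bot (R := L[X]) ?_
      refine (Submodule.eq_bot_iff _).mpr fun p hpm => ?_
      by_contra hp0
      exact hp p hp0 ((hρp p).symm.trans hpm)
    refine isDominant_of_mem_range _
      ⟨Spec.map (CommRingCat.ofHom (algebraMap B' (FractionRing B')))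
        (genericPoint (Spec (CommRingCat.of (FractionRing B')))), ?_⟩
    rw [← Scheme.Hom.comp_apply, ← hρ, Scheme.Hom.comp_apply, ← ht0]
    congr 1
    rw [hbotS, genericPoint_eq_bot_of_affine (CommRingCat.of (FractionRing B'))]
    exact PrimeSpectrum.ext hinj

end ConstantCovers

end

/-! ### Domination by covers of constant curves -/

section

open Polynomial TensorProduct

namespace ConstantCovers

/-- The theorem over an arbitrary algebraically closed field `L` containing `k` and `K`, with no
compatibility between the two inclusions. -/
theorem exists_isDominatedByCoverOfConstantCurve {k K L : Type u} [Field k] [CharZero k] [Field K]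
    [Field L] [IsAlgClosed L] [Algebra K L] [Algebra k L] {X : Scheme.{u}}
    {p : X ⟶ Spec (CommRingCat.of K)} (hX : IsCurve p) {d : ℕ}
    (hd : IsDominatedByCoverOfConstantVariety k (baseChangeHom p L) d) :
    ∃ e : ℕ, e ≤ d ∧ IsDominatedByCoverOfConstantCurve k (baseChangeHom p L) e := by
  obtain ⟨Y, r, hr, ⟨Y₀, r₀, eY, hr₀, heY⟩, Z, f, g, hf, hg, hgf⟩ := hd
  have hXg := hX.geometricallyIntegral
  have : IsIntegral (baseChange p L) := inferInstance
  -- an affine chart of the curve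
  obtain ⟨S₀, _, _, jS, ι, hι, hfinι, hjS, hjSp, hS₀⟩ := hX.exists_affine
  have := hS₀ L
  obtain ⟨t, ht, htq⟩ := exists_isOpenImmersion_baseChange jS hjSp L
  obtain ⟨ψ, hψ, hint⟩ := exists_isIntegral_injective_polynomial_tensorProduct (L := L) ι hι
    hfinι.to_isIntegral
  -- an affine chart of the constant variety
  have := hf.isIntegral
  obtain ⟨R₀, _, _, j₀, hj₀, -, hj₀r, hR₀fin, hR₀⟩ :=
    hr₀.exists_affine (pullback.fst r₀ (specMap k L) (eY.hom (genericPoint Y)))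
  have := hR₀ L
  have := hR₀ (AlgebraicClosure k)
  have : IsDomain R₀ :=
    Function.Injective.isDomain
      (Algebra.TensorProduct.includeRight : R₀ →ₐ[k] L ⊗[k] R₀).toRingHom
      (Algebra.TensorProduct.includeRight_injective (algebraMap k L).injective)
  obtain ⟨j', hj', hj'r⟩ := exists_isOpenImmersion_baseChange j₀ hj₀r L
  let j := j' ≫ eY.inv
  have hjr : j ≫ r = Spec.map (CommRingCat.ofHom (algebraMap L (L ⊗[k] R₀))) := by
    rw [← hj'r, ← heY]
    simp [j]
  -- the part of the cover over the chart, and a coordinate of the curve on it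
  obtain ⟨B, _, _, _, v, hB, hBf, hvf, hBd, hgen⟩ := hf.exists_affine_component g j
  let _ : Algebra L B := ((algebraMap (L ⊗[k] R₀) B).comp (algebraMap L (L ⊗[k] R₀))).toAlgebra
  have : IsScalarTower L (L ⊗[k] R₀) B := IsScalarTower.of_algebraMap_eq fun _ => rfl
  have hγ : (v ≫ g) ≫ baseChangeHom p L = Spec.map (CommRingCat.ofHom (algebraMap L B)) := by
    rw [Category.assoc, hgf, ← Category.assoc, hvf, Category.assoc, hjr, ← Spec.map_comp]
    rfl
  obtain ⟨b, h, hh, hbh, hdom⟩ := exists_transcendental_of_dominates_curve t htq ψ hψ hint (v ≫ g)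
    hγ hgen
  -- the constant curve, and the cover of it
  obtain ⟨A₀, _, _, ι', hι', hfinι', hA₀, φ, B', _, _, _, β, hB', hB'f, hβ, hrank, hβh, hev⟩ :=
    exists_specialization_finite_polynomial (k := k) (R₀ := R₀) hh hbh
  have := hA₀ L
  have hβL : β.comp (algebraMap L B) =
      (algebraMap (L ⊗[k] A₀) B').comp (algebraMap L (L ⊗[k] A₀)) := by
    refine RingHom.ext fun l => (hβ (algebraMap L (L ⊗[k] R₀) l)).trans ?_
    rw [RingHom.comp_apply, AlgHom.commutes]
  obtain ⟨hv, hc⟩ := isCurve_baseChangeHom_Spec (L := L) hA₀ ι' hι' hfinι'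
  let e := (pullbackSpecIso k L A₀).symm ≪≫ pullbackSymmetry _ _
  have he : e.hom ≫ baseChangeHom (Spec.map (CommRingCat.ofHom (algebraMap k A₀))) L =
      Spec.map (CommRingCat.ofHom (algebraMap L (L ⊗[k] A₀))) := by
    simp only [e, Iso.trans_hom, Iso.symm_hom, Category.assoc, pullbackSymmetry_hom_comp_snd]
    exact pullbackSpecIso_inv_fst' k L A₀
  refine ⟨Module.finrank (L ⊗[k] A₀) B', hrank.trans hBd, _, _, hc,
    ⟨_, _, Iso.refl _, hv, Category.id_comp _⟩, _, _, _, isCover_Spec e.hom,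
    hdom B' β hβh fun q hq => by rw [hβL]; exact hev q hq, ?_⟩
  rw [Category.assoc, hγ, Category.assoc, he, ← Spec.map_comp, ← Spec.map_comp,
    ← CommRingCat.ofHom_comp, ← CommRingCat.ofHom_comp, hβL]

end ConstantCovers

end

theorem mainTheorem5
    (k K Kbar : Type u) [Field k] [CharZero k] [Field K] [Algebra k K]
    (hK : ConstantCovers.IsFunctionField k K)
    [Field Kbar] [Algebra K Kbar] [IsAlgClosure K Kbar]
    [Algebra k Kbar] [IsScalarTower k K Kbar]
    (X : Scheme.{u}) (p : X ⟶ Spec (CommRingCat.of K)) (hX : ConstantCovers.IsCurve p)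
    (d : ℕ)
    (hd : ConstantCovers.IsDominatedByCoverOfConstantVariety k
      (ConstantCovers.baseChangeHom p Kbar) d) :
    ∃ e : ℕ, e ≤ d ∧
      ConstantCovers.IsDominatedByCoverOfConstantCurve k
        (ConstantCovers.baseChangeHom p Kbar) e := by
  have : IsAlgClosed Kbar := IsAlgClosure.isAlgClosed K
  exact ConstantCovers.exists_isDominatedByCoverOfConstantCurve hX hd
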